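/- A polytope is the convex hull of finitely many points of some $\mathbb R^q$, an $n$-polytope is one whose affine hull has dimension $n$, and $f_P=(1,f_0,\dots,f_{n-1},1)$ denotes the $f$-vector of an $n$-polytope $P$, where $f_d$ is the number of $d$-dimensional faces (the outer entries count the empty face and $P$ itself). A simplex $\Sigma$ spanned by $m+1$ (affinely independent) vertices of an $n$-polytope $P$ is called a special $m$-simplex of $P$ if every facet of $P$ contains exactly $m$ of these vertices. Its basis polytope $Q$ is the image of $P$ under the linear projection whose kernel is the linear subspace parallel to the affine hull of $\Sigma$. Let $\mathcal A$ be the affine hull of the union of all faces of $P$ that contain no vertex of $\Sigma$. $P$ is called meek (with respect to $\Sigma$) if $\dim Q=\dim\mathcal A$. Let $\mathcal S_{(n,m)}$ be the class of $n$-polytopes having a special $m$-simplex, and $\mathcal M_{(n,m)}$ the class of those having a special $m$-simplex with respect to which they are meek. A bipyramid over a polygon (2-polytope) $B$ is a polytope $\operatorname{conv}(B\cup\{v,w\})$ where $v,w$ lie outside the affine hull of $B$ and the open segment between $v$ and $w$ meets the relative interior of $B$. Then: 1. $\mathcal S_{(2,1)}=\mathcal M_{(2,1)}=\{P : f_P=(1,4,4,1)\}$,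 i.e. exactly the convex quadrilaterals. 2. $\mathcal S_{(3,2)}=\mathcal M_{(3,2)}=\{P : f_P=(1,5,9,6,1)\text{ or }f_P=(1,5,8,5,1)\}$. 3. $\mathcal M_{(3,1)}$ consists exactly of the bipyramids over polygons. The bipyramid over a $k$-gon ($k\ge 3$) has $f$-vector $(1,k+2,3k,2k,1)$, and for every $k\ge 3$ (and $q\geq 3$) this $f$-vector is attained by a member of $\mathcal M_{(3,1)}$ in $\mathbb R^q$. Hence the $f$-vectors of members of $\mathcal M_{(3,1)}$ are exactly the vectors $(1,k+2,3k,2k,1)$, $k\ge 3$. -/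

import Mathlib

/-- The dimension of (the affine hull of) a set, with `dim ∅ = -1`. -/
noncomputable def affDim {V : Type*} [AddCommGroup V] [Module ℝ V] (S : Set V) : ℤ :=
  open Classical in
  if S.Nonempty then (Module.finrank ℝ (vectorSpan ℝ S) : ℤ) else -1

/-- A polytope is the convex hull of finitely many points. -/
def IsPolytope {V : Type*} [AddCommGroup V] [Module ℝ V] (P : Set V) : Prop :=
  ∃ s : Finset V, P = convexHull ℝ (s : Set V)

section

variable {V : Type*} [NormedAddCommGroup V] [NormedSpace ℝ V]

/-- The face complex of `P`: the intersections of `P` with its supporting hyperplanes, together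
with `∅` and `P` itself (which is cut out by the zero functional). -/
def faceComplex (P : Set V) : Set (Set V) := {F | IsExposed ℝ P F}

/-- The facets of `P`: the faces of codimension one. -/
def facets (P : Set V) : Set (Set V) := {F | F ∈ faceComplex P ∧ affDim F = affDim P - 1}

/-- The vertex set of `P`. -/
def vertexSet (P : Set V) : Set V := {v | {v} ∈ faceComplex P}

/-- The `f`-vector `(f_{-1}, f_0, …, f_{n-1}, f_n)` of an `n`-polytope `P`, where `f_d` is the
number of `d`-dimensional faces; thus `f_{-1} = f_n = 1`. -/
noncomputable def fVector (P : Set V) : List ℕ :=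
  (List.range (affDim P + 2).toNat).map
    (fun i => {F | F ∈ faceComplex P ∧ affDim F = (i : ℤ) - 1}.ncard)

/-- The `m`-simplex `s` is special in `P`: it is spanned by `m + 1` vertices of `P`, and every
facet of `P` contains exactly `m` of them. -/
def IsSpecialSimplex (P : Set V) {m : ℕ} (s : Affine.Simplex ℝ V m) : Prop :=
  (∀ i, s.points i ∈ vertexSet P) ∧ ∀ F ∈ facets P, {i | s.points i ∈ F}.ncard = m

/-- The subcomplex of all faces of `P` that contain no vertex of the simplex `s`. -/
def avoidingComplex (P : Set V) {m : ℕ} (s : Affine.Simplex ℝ V m) : Set (Set V) :=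
  {F | F ∈ faceComplex P ∧ ∀ i, s.points i ∉ F}

/-- The basis polytope: the image of `P` under the linear projection whose kernel is the linear
subspace parallel to the affine hull of the simplex. -/
def basisPolytope (P : Set V) {m : ℕ} (s : Affine.Simplex ℝ V m) :
    Set (V ⧸ vectorSpan ℝ (Set.range s.points)) :=
  (vectorSpan ℝ (Set.range s.points)).mkQ '' P

/-- `P` is meek with respect to `s`: the basis polytope has the same dimension as the affine hull
of the complex of all faces of `P` that avoid the vertices of `s`. -/
def IsMeek (P : Set V) {m : ℕ} (s : Affine.Simplex ℝ V m) : Prop :=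
  affDim (basisPolytope P s) =
    affDim (affineSpan ℝ (⋃₀ avoidingComplex P s) : Set V)

/-- The `n`-polytopes in `V` with some special `m`-simplex. -/
def specialPolytopes (V : Type*) [NormedAddCommGroup V] [NormedSpace ℝ V] (n m : ℕ) :
    Set (Set V) :=
  {P | IsPolytope P ∧ affDim P = n ∧ ∃ s : Affine.Simplex ℝ V m, IsSpecialSimplex P s}

/-- The meek `n`-polytopes in `V` with some special `m`-simplex. -/
def meekPolytopes (V : Type*) [NormedAddCommGroup V] [NormedSpace ℝ V] (n m : ℕ) :
    Set (Set V) :=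
  {P | IsPolytope P ∧ affDim P = n ∧
    ∃ s : Affine.Simplex ℝ V m, IsSpecialSimplex P s ∧ IsMeek P s}

/-- `P` is a bipyramid with base `Q`: the convex hull of `Q` and two apices `v`, `w` outside the
affine hull of `Q` such that an interior point of the segment from `v` to `w` lies in the relative
interior of `Q`. -/
def IsBipyramidOver (P Q : Set V) : Prop :=
  ∃ v w : V, v ∉ affineSpan ℝ Q ∧ w ∉ affineSpan ℝ Q ∧
    (openSegment ℝ v w ∩ intrinsicInterior ℝ Q).Nonempty ∧
    P = convexHull ℝ (Q ∪ {v, w})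

end

/-!
Let `h` be a height function on an `(m + 1)`-polytope `P` that is constant on a special
`m`-simplex, and let `z` and `w` be vertices of extreme height. A supporting hyperplane of `P`
that contains the simplex contains all of `P`, so the simplex lies strictly between `z` and `w`.
Write a point of `P` as an affine combination of `z` and the vertices of the simplex. If the
`i`-th of these had a negative coefficient, every facet through `z` would contain it, since a
facet omits only one vertex of the simplex; then the segment from that vertex to `z` could be
prolonged inside `P` beyond `z`, contrary to the choice of `z`. Hence `P` is the hull of the
simplex, `z` and `w`: it has `m + 3` vertices and, up to scaling, one affine dependency, in which
exactly two coefficients are positive. The signs of that dependency determine which vertex sets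
are faces, and so the `f`-vector.

For `m = 1` and `P` meek, the vertices off the simplex span a hyperplane. A hyperplane supporting
their hull at the point where it crosses the simplex could be tilted to contain the simplex, so
that point is relatively interior and `P` is a bipyramid. Conversely, the proper faces of a
bipyramid are those of its base and the cones over them with either apex.
-/

section AffDim

variable {V : Type*} [AddCommGroup V] [Module ℝ V]

lemma affDim_of_nonempty {S : Set V} (hS : S.Nonempty) :
    affDim S = Module.finrank ℝ (vectorSpan ℝ S) := by
  simp [affDim, hS]

lemma affDim_empty : affDim (∅ : Set V) = -1 := by
  simp [affDim]

lemma affDim_nonneg_iff {S : Set V} : 0 ≤ affDim S ↔ S.Nonempty := by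
  by_cases hS : S.Nonempty
  · simp [affDim_of_nonempty hS, hS]
  · simp [affDim, hS]

lemma neg_one_le_affDim (S : Set V) : -1 ≤ affDim S := by
  by_cases hS : S.Nonempty
  · linarith [affDim_nonneg_iff.2 hS]
  · simp [affDim, hS]

lemma nonempty_of_affDim_eq {S : Set V} {n : ℕ} (h : affDim S = n) : S.Nonempty :=
  affDim_nonneg_iff.1 (by omega)

lemma affDim_eq_neg_one_iff {S : Set V} : affDim S = -1 ↔ S = ∅ := by
  rw [← Set.not_nonempty_iff_eq_empty, ← affDim_nonneg_iff]
  have := neg_one_le_affDim S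
  omega

lemma affDim_congr {S T : Set V} (h : affineSpan ℝ S = affineSpan ℝ T) :
    affDim S = affDim T := by
  have hne : S.Nonempty ↔ T.Nonempty := by
    rw [← affineSpan_nonempty ℝ, h, affineSpan_nonempty]
  by_cases hS : S.Nonempty
  · rw [affDim_of_nonempty hS, affDim_of_nonempty (hne.1 hS), ← direction_affineSpan, h,
      direction_affineSpan]
  · simp [affDim, hS, mt hne.2 hS]

lemma affDim_convexHull (S : Set V) : affDim (convexHull ℝ S) = affDim S :=
  affDim_congr (affineSpan_convexHull S)

lemma affDim_affineSpan (S : Set V) : affDim (affineSpan ℝ S : Set V) = affDim S :=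
  affDim_congr (AffineSubspace.affineSpan_coe _)

lemma affDim_singleton (x : V) : affDim ({x} : Set V) = 0 := by
  simp [affDim_of_nonempty]

lemma vectorSpan_insert_eq_sup {S : Set V} {x y : V} (hy : y ∈ S) :
    vectorSpan ℝ (insert x S) = vectorSpan ℝ S ⊔ Submodule.span ℝ {x - y} := by
  rw [vectorSpan_eq_span_vsub_set_right ℝ (Set.mem_insert_of_mem x hy),
    vectorSpan_eq_span_vsub_set_right ℝ hy, ← Submodule.span_union, Set.image_insert_eq,
    Set.union_singleton, vsub_eq_sub]

lemma add_mem_affineSpan {S : Set V} {x d : V} (hx : x ∈ affineSpan ℝ S)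
    (hd : d ∈ vectorSpan ℝ S) : x + d ∈ affineSpan ℝ S := by
  rw [add_comm]
  exact vadd_mem_affineSpan_of_mem_affineSpan_of_mem_vectorSpan hx hd

lemma sub_mem_vectorSpan {S : Set V} {x y : V} (hx : x ∈ affineSpan ℝ S)
    (hy : y ∈ affineSpan ℝ S) : x - y ∈ vectorSpan ℝ S :=
  vsub_mem_vectorSpan_of_mem_affineSpan_of_mem_affineSpan hx hy

lemma add_smul_sub_mem_affineSpan {S : Set V} {x y z : V} (hx : x ∈ affineSpan ℝ S)
    (hy : y ∈ affineSpan ℝ S) (hz : z ∈ affineSpan ℝ S) (c : ℝ) :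
    x + c • (y - z) ∈ affineSpan ℝ S :=
  add_mem_affineSpan hx (Submodule.smul_mem _ _ (sub_mem_vectorSpan hy hz))

lemma sum_smul_mem_affineSpan {ι : Type*} {S : Set V} {s : Finset ι} {w : ι → ℝ} {p : ι → V}
    (hw : ∑ i ∈ s, w i = 1) (hp : ∀ i ∈ s, p i ∈ affineSpan ℝ S) :
    ∑ i ∈ s, w i • p i ∈ affineSpan ℝ S := by
  obtain ⟨j, hj⟩ : s.Nonempty := Finset.nonempty_of_sum_ne_zero (hw ▸ one_ne_zero)
  have e : ∑ i ∈ s, w i • p i = p j + ∑ i ∈ s, w i • (p i - p j) := by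
    simp [smul_sub, Finset.sum_sub_distrib, ← Finset.sum_smul, hw]
  rw [e]
  exact add_mem_affineSpan (hp j hj) (Submodule.sum_mem _ fun i hi =>
    Submodule.smul_mem _ _ (sub_mem_vectorSpan (hp i hi) (hp j hj)))

variable [FiniteDimensional ℝ V]

lemma affDim_mono {S T : Set V} (h : S ⊆ T) : affDim S ≤ affDim T := by
  by_cases hS : S.Nonempty
  · rw [affDim_of_nonempty hS, affDim_of_nonempty (hS.mono h)]
    exact_mod_cast Submodule.finrank_mono (vectorSpan_mono ℝ h)
  · rw [Set.not_nonempty_iff_eq_empty.1 hS, affDim_empty]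
    exact neg_one_le_affDim T

lemma vectorSpan_eq_of_affDim_le {S T : Set V} (h : S ⊆ T)
    (hS : S.Nonempty) (hd : affDim T ≤ affDim S) : vectorSpan ℝ S = vectorSpan ℝ T := by
  rw [affDim_of_nonempty hS, affDim_of_nonempty (hS.mono h)] at hd
  exact Submodule.eq_of_le_of_finrank_le (vectorSpan_mono ℝ h) (by exact_mod_cast hd)

lemma affineSpan_eq_of_affDim_le {S T : Set V} (h : S ⊆ T)
    (hS : S.Nonempty) (hd : affDim T ≤ affDim S) : affineSpan ℝ S = affineSpan ℝ T := by
  obtain ⟨x, hx⟩ := hS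
  refine AffineSubspace.ext_of_direction_eq ?_
    ⟨x, subset_affineSpan ℝ S hx, subset_affineSpan ℝ T (h hx)⟩
  rw [direction_affineSpan, direction_affineSpan, vectorSpan_eq_of_affDim_le h ⟨x, hx⟩ hd]

lemma affDim_insert_le (S : Set V) (x : V) : affDim (insert x S) ≤ affDim S + 1 := by
  rcases S.eq_empty_or_nonempty with rfl | ⟨y, hy⟩
  · simp [affDim_empty, affDim_singleton]
  rw [affDim_of_nonempty (Set.insert_nonempty x S), affDim_of_nonempty ⟨y, hy⟩,
    vectorSpan_insert_eq_sup hy]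
  have h_sup := Submodule.finrank_add_le_finrank_add_finrank (vectorSpan ℝ S)
    (Submodule.span ℝ {x - y})
  have h_line : Module.finrank ℝ (Submodule.span ℝ {x - y}) ≤ 1 := by
    simpa using finrank_span_le_card (R := ℝ) ({x - y} : Set V)
  omega

lemma affDim_insert_of_notMem {S : Set V} {x : V} (hx : x ∉ affineSpan ℝ S) :
    affDim (insert x S) = affDim S + 1 := by
  refine le_antisymm (affDim_insert_le S x) ?_
  rcases S.eq_empty_or_nonempty with rfl | hS
  · simp [affDim_empty, affDim_singleton]
  by_contra! h
  rw [affineSpan_eq_of_affDim_le (Set.subset_insert x S) hS (by omega)] at hx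
  exact hx (subset_affineSpan ℝ _ (Set.mem_insert x S))

lemma affDim_pair {x y : V} (h : x ≠ y) : affDim ({x, y} : Set V) = 1 := by
  rw [affDim_insert_of_notMem (by simpa using h), affDim_singleton, zero_add]

lemma affDim_finset_le (s : Finset V) : affDim (s : Set V) ≤ s.card - 1 := by
  classical
  induction s using Finset.induction_on with
  | empty => simp [affDim_empty]
  | insert a s ha ih =>
    rw [Finset.coe_insert, Finset.card_insert_of_notMem ha]
    have := affDim_insert_le (s : Set V) a
    push_cast
    omega

lemma affDim_eq_zero_iff {S : Set V} : affDim S = 0 ↔ ∃ v, S = {v} := by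
  refine ⟨fun h => ?_, fun ⟨v, hv⟩ => hv ▸ affDim_singleton v⟩
  obtain ⟨v, hv⟩ := affDim_nonneg_iff.1 h.ge
  refine ⟨v, Set.eq_singleton_iff_unique_mem.2 ⟨hv, fun w hw => ?_⟩⟩
  by_contra hne
  have := affDim_mono (Set.insert_subset hw (Set.singleton_subset_iff.2 hv))
  rw [affDim_pair hne] at this
  omega

end AffDim

section Functional

section Linear

variable {V F : Type*} [AddCommGroup V] [Module ℝ V] [FunLike F V ℝ] [LinearMapClass F ℝ V ℝ]
  {S : Set V} {l : F} {M : ℝ}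

lemma map_eq_zero_of_mem_vectorSpan (h : ∀ x ∈ S, l x = M) {d : V} (hd : d ∈ vectorSpan ℝ S) :
    l d = 0 := by
  have : vectorSpan ℝ S ≤ LinearMap.ker (l : V →ₗ[ℝ] ℝ) := by
    refine Submodule.span_le.2 ?_
    rintro _ ⟨x, hx, y, hy, rfl⟩
    simp [h x hx, h y hy]
  exact this hd

lemma map_eq_of_mem_affineSpan (h : ∀ x ∈ S, l x = M) {x : V} (hx : x ∈ affineSpan ℝ S) :
    l x = M := by
  obtain ⟨y, hy⟩ : S.Nonempty := (affineSpan_nonempty (k := ℝ)).1 ⟨x, hx⟩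
  have := map_eq_zero_of_mem_vectorSpan h (sub_mem_vectorSpan hx (subset_affineSpan ℝ S hy))
  rwa [map_sub, h y hy, sub_eq_zero] at this

lemma le_of_mem_convexHull (h : ∀ x ∈ S, l x ≤ M) {x : V} (hx : x ∈ convexHull ℝ S) : l x ≤ M :=
  convexHull_min h (convex_halfSpace_le (l : V →ₗ[ℝ] ℝ).isLinear M) hx

lemma setOf_mem_convexHull_and_map_eq (h : ∀ x ∈ S, l x ≤ M) :
    {x ∈ convexHull ℝ S | l x = M} = convexHull ℝ {x ∈ S | l x = M} := by
  refine Set.Subset.antisymm ?_ (Set.subset_inter (convexHull_mono (Set.sep_subset _ _))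
    (convexHull_min (fun y hy => hy.2) (convex_hyperplane (l : V →ₗ[ℝ] ℝ).isLinear M)))
  rintro x ⟨hx, hxM⟩
  obtain ⟨ι, _, w, z, hw, hw1, hz, rfl⟩ := mem_convexHull_iff_exists_fintype.1 hx
  have slack_sum : ∑ i, w i * (M - l (z i)) = 0 := by
    simp only [mul_sub, Finset.sum_sub_distrib, ← Finset.sum_mul, hw1, one_mul]
    simp [← hxM]
  have slack : ∀ i, w i ≠ 0 → l (z i) = M := fun i hi => by
    have := (Finset.sum_eq_zero_iff_of_nonneg fun i _ =>
      mul_nonneg (hw i) (sub_nonneg.2 (h _ (hz i)))).1 slack_sum i (Finset.mem_univ i)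
    linarith [(mul_eq_zero.1 this).resolve_left hi]
  rw [← finsum_eq_sum_of_fintype]
  exact (convex_convexHull ℝ _).finsum_mem hw (by rw [finsum_eq_sum_of_fintype, hw1])
    fun i hi => subset_convexHull ℝ _ ⟨hz i, slack i hi⟩

end Linear

section Separation

variable {V : Type*} [NormedAddCommGroup V] [NormedSpace ℝ V] [FiniteDimensional ℝ V]

lemma exists_strongDual_of_notMem {p : Submodule ℝ V} {d : V} (hd : d ∉ p) (c : ℝ) :
    ∃ k : StrongDual ℝ V, (∀ x ∈ p, k x = 0) ∧ k d = c := by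
  obtain ⟨f, hf, hfd⟩ := LinearMap.exists_extend_of_notMem (0 : p →ₗ[ℝ] ℝ) hd c
  exact ⟨LinearMap.toContinuousLinearMap f, fun x hx => by simpa using congr($hf ⟨x, hx⟩), hfd⟩

lemma exists_strongDual_of_notMem_affineSpan {S : Set V} (hS : S.Nonempty) {x : V}
    (hx : x ∉ affineSpan ℝ S) (c : ℝ) :
    ∃ (k : StrongDual ℝ V) (m : ℝ), (∀ y ∈ affineSpan ℝ S, k y = m) ∧ k x = m + c := by
  obtain ⟨y, hy⟩ := hS
  have hy' := subset_affineSpan ℝ S hy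
  have hd : x - y ∉ vectorSpan ℝ S := fun h => hx (by simpa using add_mem_affineSpan hy' h)
  obtain ⟨k, hk, hkd⟩ := exists_strongDual_of_notMem hd c
  refine ⟨k, k y, fun z hz => ?_, by rw [map_sub] at hkd; linarith⟩
  simpa [sub_eq_zero] using hk _ (sub_mem_vectorSpan hz hy')

end Separation

end Functional

section Faces

variable {V : Type*} [NormedAddCommGroup V] [NormedSpace ℝ V] {P F : Set V}

lemma exists_level_of_mem_faceComplex (hF : F ∈ faceComplex P) (hne : F.Nonempty) :
    ∃ (l : StrongDual ℝ V) (M : ℝ), (∀ x ∈ P, l x ≤ M) ∧ F = {x ∈ P | l x = M} := by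
  obtain ⟨l, rfl⟩ := hF hne
  obtain ⟨y, hy, hmax⟩ := hne
  refine ⟨l, l y, hmax, ?_⟩
  ext x
  exact ⟨fun hx => ⟨hx.1, le_antisymm (hmax x hx.1) (hx.2 y hy)⟩,
    fun hx => ⟨hx.1, fun z hz => hx.2 ▸ hmax z hz⟩⟩

lemma level_mem_faceComplex {l : StrongDual ℝ V} {M : ℝ} (h : ∀ x ∈ P, l x ≤ M) :
    {x ∈ P | l x = M} ∈ faceComplex P := by
  rintro ⟨y, hy, hyM⟩
  refine ⟨l, ?_⟩
  ext x
  exact ⟨fun hx => ⟨hx.1, fun z hz => hx.2 ▸ h z hz⟩,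
    fun hx => ⟨hx.1, le_antisymm (h x hx.1) (hyM ▸ hx.2 y hy)⟩⟩

lemma subset_of_mem_faceComplex (hF : F ∈ faceComplex P) : F ⊆ P :=
  IsExposed.subset hF

lemma vertexSet_eq_exposedPoints (P : Set V) : vertexSet P = P.exposedPoints ℝ :=
  Set.ext fun _ => mem_exposedPoints_iff_exposed_singleton.symm

lemma vertexSet_subset (P : Set V) : vertexSet P ⊆ P :=
  vertexSet_eq_exposedPoints P ▸ exposedPoints_subset

lemma vertexSet_subset_extremePoints (P : Set V) : vertexSet P ⊆ P.extremePoints ℝ :=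
  vertexSet_eq_exposedPoints P ▸ exposedPoints_subset_extremePoints

lemma vertexSet_convexHull_subset (S : Set V) : vertexSet (convexHull ℝ S) ⊆ S :=
  (vertexSet_subset_extremePoints _).trans extremePoints_convexHull_subset

lemma exists_lt_of_mem_vertexSet {v : V} (hv : v ∈ vertexSet P) :
    ∃ l : StrongDual ℝ V, ∀ x ∈ P, x ≠ v → l x < l v := by
  rw [vertexSet_eq_exposedPoints] at hv
  obtain ⟨-, l, hl⟩ := hv
  exact ⟨l, fun x hx hne => (hl x hx).1.lt_of_not_ge fun h => hne ((hl x hx).2 h)⟩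

lemma notMem_convexHull_of_mem_vertexSet {v : V} (hv : v ∈ vertexSet P) {S : Set V} (hS : S ⊆ P)
    (hvS : v ∉ S) : v ∉ convexHull ℝ S := by
  intro h
  obtain ⟨l, hl⟩ := exists_lt_of_mem_vertexSet hv
  have hS' : S ⊆ {x | l x < l v} := fun x hx => hl x (hS hx) fun e => hvS (e ▸ hx)
  exact lt_irrefl (l v) (convexHull_min hS' (convex_halfSpace_lt l.toLinearMap.isLinear (l v)) h)

lemma mem_vertexSet_convexHull_of_lt {S : Set V} {v : V} (hv : v ∈ S) {l : StrongDual ℝ V}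
    (hl : ∀ x ∈ S, x ≠ v → l x < l v) : v ∈ vertexSet (convexHull ℝ S) := by
  have hle : ∀ x ∈ S, l x ≤ l v := fun x hx => by
    by_cases e : x = v
    · rw [e]
    · exact (hl x hx e).le
  have hface := level_mem_faceComplex (P := convexHull ℝ S) fun x hx => le_of_mem_convexHull hle hx
  have hlevel : {x ∈ S | l x = l v} = {v} := by
    ext x
    refine ⟨fun hx => by_contra fun e => (hl x hx.1 e).ne hx.2, ?_⟩
    rintro rfl
    exact ⟨hv, rfl⟩
  rwa [setOf_mem_convexHull_and_map_eq hle, hlevel, convexHull_singleton] at hface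

lemma mem_vertexSet_convexHull_of_notMem {S : Set V} (hS : S.Finite) {v : V} (hv : v ∈ S)
    (h : v ∉ convexHull ℝ (S \ {v})) : v ∈ vertexSet (convexHull ℝ S) := by
  have hclosed : IsClosed (convexHull ℝ (S \ {v})) :=
    Set.Finite.isClosed_convexHull (𝕜 := ℝ) (hS.subset Set.sdiff_subset)
  obtain ⟨l, u, hlu, hu⟩ := geometric_hahn_banach_closed_point (convex_convexHull ℝ _) hclosed h
  exact mem_vertexSet_convexHull_of_lt hv fun x hx hne =>
    (hlu x (subset_convexHull ℝ _ ⟨hx, hne⟩)).trans hu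

end Faces

lemma isPolytope_convexHull {V : Type*} [AddCommGroup V] [Module ℝ V] {S : Set V}
    (hS : S.Finite) : IsPolytope (convexHull ℝ S) :=
  ⟨hS.toFinset, by simp⟩

namespace IsPolytope

lemma convex {V : Type*} [AddCommGroup V] [Module ℝ V] {P : Set V} (hP : IsPolytope P) :
    Convex ℝ P := by
  obtain ⟨s, rfl⟩ := hP
  exact convex_convexHull ℝ _

variable {V : Type*} [NormedAddCommGroup V] [NormedSpace ℝ V] {P F : Set V}

lemma isCompact (hP : IsPolytope P) : IsCompact P := by
  obtain ⟨s, rfl⟩ := hP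
  exact Set.Finite.isCompact_convexHull (𝕜 := ℝ) s.finite_toSet

lemma finite_vertexSet (hP : IsPolytope P) : (vertexSet P).Finite := by
  obtain ⟨s, rfl⟩ := hP
  exact s.finite_toSet.subset (vertexSet_convexHull_subset _)

lemma extremePoints_eq_vertexSet (hP : IsPolytope P) : P.extremePoints ℝ = vertexSet P := by
  refine Set.Subset.antisymm (fun v hv => ?_) (vertexSet_subset_extremePoints P)
  have hdiff := (hP.convex.mem_extremePoints_iff_mem_sdiff_convexHull_sdiff.1 hv).2
  obtain ⟨s, rfl⟩ := hP
  exact mem_vertexSet_convexHull_of_notMem s.finite_toSet (extremePoints_convexHull_subset hv)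
    fun h => hdiff (convexHull_mono (Set.sdiff_subset_sdiff_left (subset_convexHull ℝ _)) h)

lemma convexHull_vertexSet (hP : IsPolytope P) : convexHull ℝ (vertexSet P) = P := by
  rw [← (hP.finite_vertexSet.isClosed_convexHull (𝕜 := ℝ)).closure_eq,
    ← hP.extremePoints_eq_vertexSet]
  exact closure_convexHull_extremePoints hP.isCompact hP.convex

lemma affineSpan_vertexSet (hP : IsPolytope P) : affineSpan ℝ (vertexSet P) = affineSpan ℝ P := by
  rw [← affineSpan_convexHull, hP.convexHull_vertexSet]

lemma affDim_vertexSet (hP : IsPolytope P) : affDim (vertexSet P) = affDim P :=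
  affDim_congr hP.affineSpan_vertexSet

lemma vertexSet_nonempty (hP : IsPolytope P) (hne : P.Nonempty) : (vertexSet P).Nonempty := by
  rwa [← hP.convexHull_vertexSet, convexHull_nonempty_iff] at hne

lemma le_of_forall_vertexSet_le (hP : IsPolytope P) {l : StrongDual ℝ V} {M : ℝ}
    (h : ∀ v ∈ vertexSet P, l v ≤ M) : ∀ x ∈ P, l x ≤ M := fun x hx => by
  rw [← hP.convexHull_vertexSet] at hx
  exact le_of_mem_convexHull h hx

lemma exists_max (hP : IsPolytope P) (hne : P.Nonempty) (l : StrongDual ℝ V) :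
    ∃ u ∈ vertexSet P, ∀ x ∈ P, l x ≤ l u := by
  obtain ⟨u, hu, hmax⟩ := Set.exists_max_image (vertexSet P) l hP.finite_vertexSet
    (hP.vertexSet_nonempty hne)
  exact ⟨u, hu, hP.le_of_forall_vertexSet_le hmax⟩

lemma level_eq_convexHull (hP : IsPolytope P) {l : StrongDual ℝ V} {M : ℝ}
    (hl : ∀ x ∈ P, l x ≤ M) :
    {x ∈ P | l x = M} = convexHull ℝ {x ∈ vertexSet P | l x = M} := by
  rw [← setOf_mem_convexHull_and_map_eq fun x hx => hl x (vertexSet_subset P hx),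
    hP.convexHull_vertexSet]

lemma face_eq_convexHull (hP : IsPolytope P) (hF : F ∈ faceComplex P) :
    F = convexHull ℝ (F ∩ vertexSet P) := by
  rcases F.eq_empty_or_nonempty with rfl | hne
  · simp
  obtain ⟨l, M, hl, rfl⟩ := exists_level_of_mem_faceComplex hF hne
  conv_lhs => rw [hP.level_eq_convexHull hl]
  congr 1
  ext x
  exact ⟨fun h => ⟨⟨vertexSet_subset P h.1, h.2⟩, h.1⟩, fun h => ⟨h.2, h.1.2⟩⟩

lemma finite_faceComplex (hP : IsPolytope P) : (faceComplex P).Finite := by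
  refine Set.Finite.of_finite_image (f := fun F => F ∩ vertexSet P)
    (hP.finite_vertexSet.finite_subsets.subset ?_) fun F hF G hG h => ?_
  · rintro _ ⟨F, -, rfl⟩
    exact Set.inter_subset_right
  · rw [hP.face_eq_convexHull hF, hP.face_eq_convexHull hG]
    exact congrArg _ h

lemma exists_tilt (hP : IsPolytope P) {l k : StrongDual ℝ V} {M m : ℝ} (hl : ∀ y ∈ P, l y ≤ M)
    (hk : ∀ y ∈ P, l y = M → k y = m) (hne : ∃ u ∈ P, m < k u) :
    ∃ t > 0, (∀ y ∈ P, (l + t • k) y ≤ M + t * m) ∧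
      ∃ w ∈ P, m < k w ∧ (l + t • k) w = M + t * m := by
  set T := {v ∈ vertexSet P | m < k v}
  have hTne : T.Nonempty := by
    by_contra h
    obtain ⟨u, hu, hmu⟩ := hne
    refine (hP.le_of_forall_vertexSet_le (l := k) (M := m) (fun v hv => ?_) u hu).not_gt hmu
    by_contra! hlt
    exact h ⟨v, hv, hlt⟩
  have hTP : ∀ {v}, v ∈ T → v ∈ P := fun hv => vertexSet_subset P hv.1
  have hTlt : ∀ {v}, v ∈ T → l v < M := fun hv =>
    lt_of_le_of_ne (hl _ (hTP hv)) fun e => hv.2.ne' (hk _ (hTP hv) e)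
  obtain ⟨w, hw, hwmin⟩ := Set.exists_min_image T (fun v => (M - l v) / (k v - m))
    (hP.finite_vertexSet.subset (Set.sep_subset _ _)) hTne
  set t := (M - l w) / (k w - m)
  have ht : 0 < t := div_pos (sub_pos.2 (hTlt hw)) (sub_pos.2 hw.2)
  refine ⟨t, ht, hP.le_of_forall_vertexSet_le fun v hv => ?_, w, hTP hw, hw.2, ?_⟩
  · simp only [add_apply, smul_apply, smul_eq_mul]
    by_cases hvT : m < k v
    · have := hwmin v ⟨hv, hvT⟩
      rw [le_div_iff₀ (sub_pos.2 hvT)] at this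
      linarith
    · have := mul_le_mul_of_nonneg_left (not_lt.1 hvT) ht.le
      linarith [hl v (vertexSet_subset P hv)]
  · have : t * (k w - m) = M - l w := div_mul_cancel₀ _ (sub_pos.2 hw.2).ne'
    simp only [add_apply, smul_apply, smul_eq_mul]
    linarith

end IsPolytope

section Facets

variable {V : Type*} [NormedAddCommGroup V] [NormedSpace ℝ V] [FiniteDimensional ℝ V] {P : Set V}

lemma affDim_level_lt {l : StrongDual ℝ V} {M : ℝ} (hne : ∃ y ∈ P, l y = M) {x : V}
    (hx : x ∈ affineSpan ℝ P) (hlx : l x ≠ M) : affDim {y ∈ P | l y = M} < affDim P := by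
  by_contra! h
  rw [← affineSpan_eq_of_affDim_le (Set.sep_subset _ _) hne h] at hx
  exact hlx (map_eq_of_mem_affineSpan (fun y hy => hy.2) hx)

namespace IsPolytope

lemma exists_level_affDim_lt (hP : IsPolytope P) {l : StrongDual ℝ V} {M : ℝ}
    (hl : ∀ y ∈ P, l y ≤ M) {x : V} (hx : x ∈ affineSpan ℝ P)
    (hd : affDim {y ∈ P | l y = M} + 1 < affDim P) :
    ∃ (l' : StrongDual ℝ V) (M' : ℝ), (∀ y ∈ P, l' y ≤ M') ∧ (∀ y ∈ P, l y = M → l' y = M') ∧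
      affDim {y ∈ P | l y = M} < affDim {y ∈ P | l' y = M'} ∧ l' x - M' = l x - M := by
  set F := {y ∈ P | l y = M}
  have hxF : insert x F ⊆ affineSpan ℝ P :=
    Set.insert_subset hx ((Set.sep_subset _ _).trans (subset_affineSpan ℝ P))
  obtain ⟨u, huP, hu⟩ : ∃ u ∈ P, u ∉ affineSpan ℝ (insert x F) := by
    by_contra! h
    have := affDim_congr ((affineSpan_le.2 hxF).antisymm (affineSpan_le.2 h))
    linarith [affDim_insert_le F x]
  obtain ⟨k, m, hk, hku⟩ :=
    exists_strongDual_of_notMem_affineSpan (Set.insert_nonempty x F) hu 1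
  have hkF : ∀ y ∈ F, k y = m := fun y hy =>
    hk y (subset_affineSpan ℝ _ (Set.mem_insert_of_mem x hy))
  have hkx : k x = m := hk x (subset_affineSpan ℝ _ (Set.mem_insert x F))
  obtain ⟨t, -, hvalid, w, hwP, hkw, hw⟩ :=
    hP.exists_tilt hl (fun y hy h => hkF y ⟨hy, h⟩) ⟨u, huP, by linarith⟩
  have hface : ∀ y ∈ P, l y = M → (l + t • k) y = M + t * m := fun y hy h => by
    simp [h, hkF y ⟨hy, h⟩]
  refine ⟨l + t • k, M + t * m, hvalid, hface, ?_, by simp [hkx]⟩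
  have hwF : w ∉ affineSpan ℝ F := fun h => hkw.ne' (map_eq_of_mem_affineSpan hkF h)
  rw [← Int.add_one_le_iff, ← affDim_insert_of_notMem hwF]
  exact affDim_mono (Set.insert_subset ⟨hwP, hw⟩ fun y hy => ⟨hy.1, hface y hy.1 hy.2⟩)

/- The supporting hyperplane is rotated about the span of the face and `x`; this preserves
`l x - M`, so the facet found in the end still separates `x` strictly. -/
lemma exists_facet_of_level (hP : IsPolytope P) {l : StrongDual ℝ V} {M : ℝ}
    (hl : ∀ y ∈ P, l y ≤ M) (hne : ∃ y ∈ P, l y = M) {x : V} (hx : x ∈ affineSpan ℝ P)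
    (hlx : l x ≠ M) :
    ∃ (l' : StrongDual ℝ V) (M' : ℝ), (∀ y ∈ P, l' y ≤ M') ∧ (∀ y ∈ P, l y = M → l' y = M') ∧
      affDim {y ∈ P | l' y = M'} = affDim P - 1 ∧ l' x - M' = l x - M := by
  induction hn : (affDim P - affDim {y ∈ P | l y = M}).toNat using Nat.strong_induction_on
    generalizing l M with | _ n ih
  have hlt := affDim_level_lt hne hx hlx
  by_cases hd : affDim {y ∈ P | l y = M} = affDim P - 1
  · exact ⟨l, M, hl, fun y _ h => h, hd, rfl⟩
  obtain ⟨l₁, M₁, hl₁, hface₁, hlt₁, hx₁⟩ := hP.exists_level_affDim_lt hl hx (by omega)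
  obtain ⟨l', M', hl', hface', hd', hx'⟩ := ih _ (by omega) hl₁
    (hne.imp fun y hy => ⟨hy.1, hface₁ y hy.1 hy.2⟩)
    (by rw [← sub_ne_zero, hx₁]; exact sub_ne_zero.2 hlx) rfl
  exact ⟨l', M', hl', fun y hy h => hface' y hy (hface₁ y hy h), hd', hx'.trans hx₁⟩

lemma exists_facet_notMem (hP : IsPolytope P) {l : StrongDual ℝ V} {M : ℝ}
    (hl : ∀ y ∈ P, l y ≤ M) (hne : ∃ y ∈ P, l y = M) {x : V} (hx : x ∈ P)
    (hlx : l x ≠ M) : ∃ F ∈ facets P, x ∉ F ∧ ∀ y ∈ P, l y = M → y ∈ F := by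
  obtain ⟨l', M', hl', hface, hd, hx'⟩ :=
    hP.exists_facet_of_level hl hne (subset_affineSpan ℝ P hx) hlx
  refine ⟨_, ⟨level_mem_faceComplex hl', hd⟩, fun h => hlx ?_, fun y hy h => ⟨hy, hface y hy h⟩⟩
  rw [h.2, sub_self] at hx'
  linarith

lemma exists_facet_lt_of_notMem (hP : IsPolytope P) (hne : P.Nonempty) {x : V}
    (hx : x ∈ affineSpan ℝ P) (hxP : x ∉ P) :
    ∃ (l : StrongDual ℝ V) (M : ℝ), (∀ y ∈ P, l y ≤ M) ∧ (∃ y ∈ P, l y = M) ∧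
      {y ∈ P | l y = M} ∈ facets P ∧ M < l x := by
  obtain ⟨f, u, hf, hu⟩ := geometric_hahn_banach_closed_point hP.convex
    hP.isCompact.isClosed hxP
  obtain ⟨y, hy, hmax⟩ := hP.exists_max hne f
  have hyP := vertexSet_subset P hy
  have hlt := (hf y hyP).trans hu
  obtain ⟨l, M, hl, hface, hd, hlx⟩ := hP.exists_facet_of_level hmax ⟨y, hyP, rfl⟩ hx hlt.ne'
  exact ⟨l, M, hl, ⟨y, hyP, hface y hyP rfl⟩, ⟨level_mem_faceComplex hl, hd⟩, by linarith⟩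

end IsPolytope

lemma exists_nonneg_mul_of_facet {l l' : StrongDual ℝ V} {M M' : ℝ}
    (hl : ∀ y ∈ P, l y ≤ M) (hl' : ∀ y ∈ P, l' y ≤ M')
    (hsub : ∀ y ∈ P, l y = M → l' y = M')
    (hd : affDim {y ∈ P | l y = M} = affDim P - 1) :
    ∃ c : ℝ, 0 ≤ c ∧ ∀ x ∈ affineSpan ℝ P, l' x - M' = c * (l x - M) := by
  set F := {y ∈ P | l y = M}
  have hFP : F ⊆ P := Set.sep_subset _ _
  obtain ⟨o, ho, hoF⟩ : ∃ o ∈ P, o ∉ F := by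
    by_contra! h
    rw [(show P ⊆ F from h).antisymm hFP] at hd
    omega
  have hlo : l o < M := lt_of_le_of_ne (hl o ho) fun e => hoF ⟨ho, e⟩
  have hspan : affineSpan ℝ (insert o F) = affineSpan ℝ P := by
    refine affineSpan_eq_of_affDim_le (Set.insert_subset ho hFP) (Set.insert_nonempty o F) ?_
    rw [affDim_insert_of_notMem fun h => hlo.ne (map_eq_of_mem_affineSpan (fun y hy => hy.2) h)]
    omega
  set c := (l' o - M') / (l o - M)
  refine ⟨c, div_nonneg_of_nonpos (sub_nonpos.2 (hl' o ho)) (sub_nonpos.2 hlo.le), ?_⟩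
  have hco : c * (l o - M) = l' o - M' := div_mul_cancel₀ _ (sub_neg.2 hlo).ne
  have key : ∀ y ∈ insert o F, (l' - c • l) y = M' - c * M := by
    rintro y (rfl | hy) <;> simp only [sub_apply, smul_apply, smul_eq_mul]
    · linarith
    · rw [hsub y hy.1 hy.2, hy.2]
  intro x hx
  have := map_eq_of_mem_affineSpan key (hspan ▸ hx)
  simp only [sub_apply, smul_apply, smul_eq_mul] at this
  linarith

namespace IsPolytope

lemma exists_halfspace_representation (hP : IsPolytope P) (hne : P.Nonempty) :
    ∃ S : Finset (StrongDual ℝ V × ℝ),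
      (∀ p ∈ S, (∀ y ∈ P, p.1 y ≤ p.2) ∧ {y ∈ P | p.1 y = p.2} ∈ facets P) ∧
      ∀ x ∈ affineSpan ℝ P, (∀ p ∈ S, p.1 x ≤ p.2) → x ∈ P := by
  classical
  have hchoice : ∀ F ∈ {F ∈ facets P | F.Nonempty}, ∃ p : StrongDual ℝ V × ℝ,
      (∀ y ∈ P, p.1 y ≤ p.2) ∧ F = {y ∈ P | p.1 y = p.2} := fun F hF => by
    obtain ⟨l, M, h⟩ := exists_level_of_mem_faceComplex hF.1.1 hF.2
    exact ⟨(l, M), h⟩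
  choose! p hp using hchoice
  have hfin : {F ∈ facets P | F.Nonempty}.Finite :=
    hP.finite_faceComplex.subset fun F hF => hF.1.1
  refine ⟨hfin.toFinset.image p, fun q hq => ?_, fun x hx hS => ?_⟩
  · obtain ⟨F, hF, rfl⟩ := Finset.mem_image.1 hq
    rw [Set.Finite.mem_toFinset] at hF
    exact ⟨(hp F hF).1, (hp F hF).2 ▸ hF.1⟩
  · by_contra hxP
    obtain ⟨l, M, hl, hlne, hF, hlt⟩ := hP.exists_facet_lt_of_notMem hne hx hxP
    set F := {y ∈ P | l y = M}
    obtain ⟨hvalid, hlevel⟩ := hp F ⟨hF, hlne⟩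
    have hle := hS _ (Finset.mem_image_of_mem p (hfin.mem_toFinset.2 ⟨hF, hlne⟩))
    obtain ⟨c, hc, hcx⟩ := exists_nonneg_mul_of_facet hvalid hl
      (fun y hy h => (hlevel.superset ⟨hy, h⟩).2) (hlevel ▸ hF.2)
    linarith [hcx x hx, mul_nonpos_of_nonneg_of_nonpos hc (sub_nonpos.2 hle)]

lemma exists_extend (hP : IsPolytope P) {z v : V} (hz : z ∈ P) (hv : v ∈ P)
    (h : ∀ F ∈ facets P, z ∈ F → v ∈ F) : ∃ ε : ℝ, 0 < ε ∧ z + ε • (z - v) ∈ P := by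
  obtain ⟨S, hS, hrep⟩ := hP.exists_halfspace_representation ⟨z, hz⟩
  have hev : ∀ᶠ ε : ℝ in nhdsWithin 0 (Set.Ioi 0), ∀ p ∈ S, p.1 (z + ε • (z - v)) ≤ p.2 := by
    refine (Filter.eventually_all_finset S).2 fun p hp => ?_
    obtain ⟨hvalid, hfacet⟩ := hS p hp
    by_cases hzp : p.1 z = p.2
    · have := (h _ hfacet ⟨hz, hzp⟩).2
      exact Filter.Eventually.of_forall fun ε => by simp [hzp, this]
    · have hlt : p.1 (z + (0 : ℝ) • (z - v)) < p.2 := by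
        simpa using lt_of_le_of_ne (hvalid z hz) hzp
      have hc : Continuous fun ε : ℝ => p.1 (z + ε • (z - v)) := by fun_prop
      exact ((hc.tendsto 0).eventually_lt_const hlt).filter_mono nhdsWithin_le_nhds |>.mono
        fun ε hε => hε.le
  obtain ⟨ε, hε, hpos⟩ := (hev.and self_mem_nhdsWithin).exists
  have hz' := subset_affineSpan ℝ P hz
  exact ⟨ε, hpos, hrep _
    (add_smul_sub_mem_affineSpan hz' hz' (subset_affineSpan ℝ P hv) ε) hε⟩

lemma exists_le_of_notMem_intrinsicInterior (hP : IsPolytope P) (hne : P.Nonempty)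
    {x : V} (hx : x ∈ affineSpan ℝ P) (hxi : x ∉ intrinsicInterior ℝ P) :
    ∃ (l : StrongDual ℝ V) (M : ℝ), (∀ y ∈ P, l y ≤ M) ∧ (∃ y ∈ P, l y < M) ∧ M ≤ l x := by
  obtain ⟨S, hS, hrep⟩ := hP.exists_halfspace_representation hne
  by_contra! h
  refine hxi (mem_intrinsicInterior.2 ⟨⟨x, hx⟩, mem_interior_iff_mem_nhds.2 ?_, rfl⟩)
  have hev : ∀ᶠ y : affineSpan ℝ P in nhds ⟨x, hx⟩, ∀ p ∈ S, p.1 y ≤ p.2 := by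
    refine (Filter.eventually_all_finset S).2 fun p hp => ?_
    obtain ⟨hvalid, hfacet⟩ := hS p hp
    have hlt : ∃ y ∈ P, p.1 y < p.2 := by
      by_contra! hge
      have hall : {y ∈ P | p.1 y = p.2} = P :=
        Set.sep_eq_self_iff_mem_true.2 fun y hy => (hvalid y hy).antisymm (hge y hy)
      have := hfacet.2
      rw [hall] at this
      omega
    have hc : Continuous fun y : affineSpan ℝ P => p.1 (y : V) := by fun_prop
    exact ((hc.tendsto ⟨x, hx⟩).eventually_lt_const (h p.1 p.2 hvalid hlt)).mono fun y hy => hy.le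
  filter_upwards [hev] with y hy
  exact hrep y y.2 hy

end IsPolytope

end Facets

section IntrinsicInterior

variable {V : Type*} [NormedAddCommGroup V] [NormedSpace ℝ V] {Q : Set V} {p : V}

lemma exists_extend_of_mem_intrinsicInterior (hp : p ∈ intrinsicInterior ℝ Q) {y : V}
    (hy : y ∈ affineSpan ℝ Q) : ∃ ε : ℝ, 0 < ε ∧ p + ε • (p - y) ∈ Q := by
  obtain ⟨⟨p, hpQ⟩, hpi, rfl⟩ := mem_intrinsicInterior.1 hp
  let f : ℝ → affineSpan ℝ Q := fun ε =>
    ⟨p + ε • (p - y), add_smul_sub_mem_affineSpan hpQ hpQ hy ε⟩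
  have hf : Continuous f := Continuous.subtype_mk (by fun_prop) _
  have hf0 : f 0 = ⟨p, hpQ⟩ := by simp [f]
  have hev : ∀ᶠ ε in nhdsWithin 0 (Set.Ioi (0 : ℝ)), (f ε : V) ∈ Q :=
    ((hf0 ▸ hf.tendsto 0).eventually (mem_interior_iff_mem_nhds.1 hpi)).filter_mono
      nhdsWithin_le_nhds
  obtain ⟨ε, hε, hpos⟩ := (hev.and self_mem_nhdsWithin).exists
  exact ⟨ε, hpos, hε⟩

lemma eq_of_mem_intrinsicInterior (hp : p ∈ intrinsicInterior ℝ Q) {l : StrongDual ℝ V} {M : ℝ}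
    (hl : ∀ y ∈ Q, l y ≤ M) (hlp : l p = M) : ∀ y ∈ Q, l y = M := by
  intro y hy
  obtain ⟨ε, hε, hmem⟩ := exists_extend_of_mem_intrinsicInterior hp (subset_affineSpan ℝ Q hy)
  have hle := hl _ hmem
  simp only [map_add, map_smul, map_sub, smul_eq_mul, hlp] at hle
  exact (hl y hy).antisymm (sub_nonpos.1 (nonpos_of_mul_nonpos_right (by linarith) hε))

end IntrinsicInterior

section Circuit

variable {V ι : Type*}

lemma finrank_map_add_finrank_inf_ker {K M N : Type*} [DivisionRing K] [AddCommGroup M]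
    [Module K M] [AddCommGroup N] [Module K N] (f : M →ₗ[K] N) (p : Submodule K M)
    [FiniteDimensional K p] :
    Module.finrank K (p.map f) + Module.finrank K ↥(p ⊓ LinearMap.ker f) = Module.finrank K p := by
  have hker : LinearMap.ker (f.domRestrict p) = (p ⊓ LinearMap.ker f).comap p.subtype := by
    ext y
    simp
  rw [← LinearMap.finrank_range_add_finrank_ker (f.domRestrict p), LinearMap.range_domRestrict,
    hker, (Submodule.comapSubtypeEquivOfLe inf_le_left).finrank_eq]

/-- `g` is, up to scaling, the only affine dependency of the family `x`. -/
structure IsAffineCircuit [AddCommGroup V] [Module ℝ V] [Fintype ι] (x : ι → V)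
    (g : ι → ℝ) : Prop where
  sum_eq : ∑ i, g i = 0
  sum_smul_eq : ∑ i, g i • x i = 0
  ne_zero : g ≠ 0
  unique : ∀ c : ι → ℝ, ∑ i, c i = 0 → ∑ i, c i • x i = 0 → ∃ r : ℝ, c = r • g

variable [Fintype ι]

section AffineDependencies

variable [AddCommGroup V] [Module ℝ V]

/-- The space of affine dependencies of a finite family. -/
def affineDependencies (x : ι → V) : Submodule ℝ (ι → ℝ) :=
  LinearMap.ker (Fintype.linearCombination ℝ fun _ : ι => (1 : ℝ)) ⊓
    LinearMap.ker (Fintype.linearCombination ℝ x)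

lemma mem_affineDependencies {x : ι → V} {c : ι → ℝ} :
    c ∈ affineDependencies x ↔ ∑ i, c i = 0 ∧ ∑ i, c i • x i = 0 := by
  simp [affineDependencies, Fintype.linearCombination_apply]

lemma map_ker_sum_eq_vectorSpan [Nonempty ι] (x : ι → V) :
    (LinearMap.ker (Fintype.linearCombination ℝ fun _ : ι => (1 : ℝ))).map
      (Fintype.linearCombination ℝ x) = vectorSpan ℝ (Set.range x) := by
  classical
  refine le_antisymm ?_ (Submodule.span_le.2 ?_)
  · rintro _ ⟨c, hc, rfl⟩
    obtain ⟨j⟩ := ‹Nonempty ι›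
    have hc : ∑ i, c i = 0 := by simpa [Fintype.linearCombination_apply] using hc
    have hsub : Fintype.linearCombination ℝ x c = ∑ i, c i • (x i - x j) := by
      simp [Fintype.linearCombination_apply, smul_sub, Finset.sum_sub_distrib, ← Finset.sum_smul,
        hc]
    rw [hsub]
    exact Submodule.sum_mem _ fun i _ => Submodule.smul_mem _ _
      (vsub_mem_vectorSpan ℝ ⟨i, rfl⟩ ⟨j, rfl⟩)
  · rintro _ ⟨_, ⟨i, rfl⟩, _, ⟨j, rfl⟩, rfl⟩
    exact ⟨Pi.single i 1 - Pi.single j 1,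
      by simp [Fintype.linearCombination_apply],
      by simp [Fintype.linearCombination_apply, sub_smul, Pi.single_apply]⟩

lemma finrank_affineDependencies [Nonempty ι] (x : ι → V) :
    Module.finrank ℝ (vectorSpan ℝ (Set.range x)) + Module.finrank ℝ (affineDependencies x) + 1 =
      Fintype.card ι := by
  classical
  have hsurj :
      Function.Surjective (Fintype.linearCombination ℝ fun _ : ι => (1 : ℝ)) := fun r => by
    obtain ⟨i⟩ := ‹Nonempty ι›
    exact ⟨Pi.single i r, by simp [Fintype.linearCombination_apply]⟩
  have hrank := LinearMap.finrank_range_add_finrank_ker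
    (Fintype.linearCombination ℝ fun _ : ι => (1 : ℝ))
  rw [LinearMap.range_eq_top.2 hsurj, finrank_top, Module.finrank_self,
    Module.finrank_fintype_fun_eq_card] at hrank
  rw [← map_ker_sum_eq_vectorSpan, affineDependencies, finrank_map_add_finrank_inf_ker]
  omega

lemma affDim_range_of_independent {x : ι → V}
    (h : ∀ c : ι → ℝ, ∑ i, c i = 0 → ∑ i, c i • x i = 0 → c = 0) :
    affDim (Set.range x) = Fintype.card ι - 1 := by
  cases isEmpty_or_nonempty ι
  · simp [Set.range_eq_empty, affDim_empty]
  · have hbot : affineDependencies x = ⊥ := (Submodule.eq_bot_iff _).2 fun c hc =>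
      h c (mem_affineDependencies.1 hc).1 (mem_affineDependencies.1 hc).2
    have hrank := finrank_affineDependencies x
    rw [hbot, finrank_bot] at hrank
    rw [affDim_of_nonempty (Set.range_nonempty x)]
    omega

lemma exists_isAffineCircuit [Nonempty ι] {x : ι → V}
    (h : affDim (Set.range x) = Fintype.card ι - 2) : ∃ g, IsAffineCircuit x g := by
  have hrank := finrank_affineDependencies x
  rw [affDim_of_nonempty (Set.range_nonempty x)] at h
  obtain ⟨⟨g, hg⟩, hg0, hspan⟩ := finrank_eq_one_iff'.1
    (show Module.finrank ℝ (affineDependencies x) = 1 by omega)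
  rw [mem_affineDependencies] at hg
  refine ⟨g, hg.1, hg.2, fun e => hg0 (by simp [e]), fun c hc hc' => ?_⟩
  obtain ⟨r, hr⟩ := hspan ⟨c, mem_affineDependencies.2 ⟨hc, hc'⟩⟩
  exact ⟨r, (congrArg Subtype.val hr).symm⟩

end AffineDependencies

/-- The condition on `J` for the points indexed by `J` to be the vertices of a face of a
configuration whose only affine dependency has positive and negative supports `p` and `n`. -/
abbrev IsCircuitFace [DecidableEq ι] (p n J : Finset ι) : Prop := (∃ i ∈ p, i ∉ J) ↔ ∃ i ∈ n, i ∉ J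

/-- The dimension of the hull of the points indexed by `J`, in a configuration whose only affine
dependency has positive and negative supports `p` and `n`. -/
abbrev circuitDim [DecidableEq ι] (p n J : Finset ι) : ℤ :=
  J.card - 1 - if p ∪ n ⊆ J then 1 else 0

lemma IsCircuitFace.exists_nonneg [DecidableEq ι] {g : ι → ℝ} {J : Finset ι}
    (hJ : IsCircuitFace {i | 0 < g i} {i | g i < 0} J) :
    ∃ y : ι → ℝ, (∀ i, 0 ≤ y i) ∧ (∀ i, y i = 0 ↔ i ∈ J) ∧ ∑ i, g i * y i = 0 := by
  simp only [IsCircuitFace, Finset.mem_filter, Finset.mem_univ, true_and] at hJ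
  have add_single {j : ι} (hj : j ∉ J) (r : ℝ) :
      ∑ i ∈ Jᶜ, g i * (1 + Pi.single (M := fun _ => ℝ) j r i) = ∑ i ∈ Jᶜ, g i + g j * r := by
    simp [mul_add, Finset.sum_add_distrib, Pi.single_apply, hj]
  obtain ⟨t, ht, hsum⟩ : ∃ t : ι → ℝ, (∀ i, 0 ≤ t i) ∧ ∑ i ∈ Jᶜ, g i * (1 + t i) = 0 := by
    rcases lt_trichotomy (∑ i ∈ Jᶜ, g i) 0 with hlt | heq | hgt
    · obtain ⟨i, hi, hineg⟩ := Finset.exists_lt_of_sum_lt (g := fun _ => (0 : ℝ))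
        (by simpa using hlt)
      obtain ⟨j, hj, hjJ⟩ := hJ.2 ⟨i, hineg, Finset.mem_compl.1 hi⟩
      have hr : 0 ≤ -(∑ i ∈ Jᶜ, g i) / g j := div_nonneg (neg_nonneg.2 hlt.le) hj.le
      refine ⟨Pi.single j _, (Pi.single_nonneg (α := fun _ => ℝ)).2 hr, ?_⟩
      rw [add_single hjJ, mul_div_cancel₀ _ hj.ne', add_neg_cancel]
    · exact ⟨0, by simp, by simpa using heq⟩
    · obtain ⟨i, hi, hipos⟩ := Finset.exists_lt_of_sum_lt (f := fun _ => (0 : ℝ))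
        (by simpa using hgt)
      obtain ⟨j, hj, hjJ⟩ := hJ.1 ⟨i, hipos, Finset.mem_compl.1 hi⟩
      have hr : 0 ≤ -(∑ i ∈ Jᶜ, g i) / g j := div_nonneg_of_nonpos (neg_nonpos.2 hgt.le) hj.le
      refine ⟨Pi.single j _, (Pi.single_nonneg (α := fun _ => ℝ)).2 hr, ?_⟩
      rw [add_single hjJ, mul_div_cancel₀ _ hj.ne, add_neg_cancel]
  refine ⟨fun i => if i ∈ J then 0 else 1 + t i, fun i => ?_, fun i => ?_, ?_⟩
  · dsimp only
    split_ifs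
    exacts [le_rfl, by linarith [ht i]]
  · by_cases hi : i ∈ J
    · simp [hi]
    · simpa [hi] using (by linarith [ht i] : 1 + t i ≠ 0)
  · refine Eq.trans (Finset.sum_subset (Finset.subset_univ Jᶜ) fun i _ hi => ?_).symm
      ((Finset.sum_congr rfl fun i hi => ?_).trans hsum)
    · simp [Finset.notMem_compl.1 hi]
    · simp [Finset.mem_compl.1 hi]

lemma IsCircuitFace.of_nonneg [DecidableEq ι] {g y : ι → ℝ} {J : Finset ι} (hy : ∀ i, 0 ≤ y i)
    (hyJ : ∀ i, y i = 0 ↔ i ∈ J) (hsum : ∑ i, g i * y i = 0) :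
    IsCircuitFace {i | 0 < g i} {i | g i < 0} J := by
  have hypos : ∀ i ∉ J, 0 < y i := fun i hi => (hy i).lt_of_ne fun e => hi ((hyJ i).1 e.symm)
  have exists_neg {f : ι → ℝ} (hf : ∑ i, f i * y i = 0) {i : ι} (hi : 0 < f i) (hiJ : i ∉ J) :
      ∃ j, f j < 0 ∧ j ∉ J := by
    by_contra! hneg
    refine hf.not_gt (Finset.sum_pos' (fun k _ => ?_)
      ⟨i, Finset.mem_univ i, mul_pos hi (hypos i hiJ)⟩)
    by_cases hk : k ∈ J
    · simp [(hyJ k).2 hk]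
    · exact mul_nonneg (not_lt.1 fun hg => hk (hneg k hg)) (hy k)
  simp only [IsCircuitFace, Finset.mem_filter, Finset.mem_univ, true_and]
  constructor
  · rintro ⟨i, hi, hiJ⟩
    exact exists_neg hsum hi hiJ
  · rintro ⟨i, hi, hiJ⟩
    obtain ⟨j, hj, hjJ⟩ := exists_neg (f := -g) (by simpa using hsum) (neg_pos.2 hi) hiJ
    exact ⟨j, neg_lt_zero.1 hj, hjJ⟩

namespace IsAffineCircuit

section Module

variable [AddCommGroup V] [Module ℝ V] {x : ι → V} {g : ι → ℝ}

lemma smul (h : IsAffineCircuit x g) {r : ℝ} (hr : r ≠ 0) : IsAffineCircuit x (r • g) where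
  sum_eq := by simp [← Finset.mul_sum, h.sum_eq]
  sum_smul_eq := by simp [mul_smul, ← Finset.smul_sum, h.sum_smul_eq]
  ne_zero := smul_ne_zero hr h.ne_zero
  unique c hc hc' := by
    obtain ⟨s, hs⟩ := h.unique c hc hc'
    exact ⟨s / r, by rw [smul_smul, div_mul_cancel₀ _ hr, hs]⟩

lemma neg (h : IsAffineCircuit x g) : IsAffineCircuit x (-g) := by
  simpa using h.smul (neg_ne_zero.2 one_ne_zero)

lemma of_dependency (h : IsAffineCircuit x g) {c : ι → ℝ} (hc : ∑ i, c i = 0)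
    (hc' : ∑ i, c i • x i = 0) (hne : c ≠ 0) : IsAffineCircuit x c := by
  obtain ⟨r, rfl⟩ := h.unique c hc hc'
  exact h.smul fun e => hne (by simp [e])

lemma exists_pos (h : IsAffineCircuit x g) : ∃ i, 0 < g i := by
  by_contra! hn
  exact h.ne_zero (funext fun i =>
    (Finset.sum_eq_zero_iff_of_nonpos fun i _ => hn i).1 h.sum_eq i (Finset.mem_univ i))

lemma exists_neg (h : IsAffineCircuit x g) : ∃ i, g i < 0 := by
  simpa using h.neg.exists_pos

lemma affDim_image_of_notMem (h : IsAffineCircuit x g) {J : Finset ι} {i : ι} (hi : i ∉ J)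
    (hgi : g i ≠ 0) : affDim (x '' J) = J.card - 1 := by
  classical
  rw [Set.image_eq_range]
  refine (affDim_range_of_independent fun c hc hcx => ?_).trans (by simp)
  let c' : ι → ℝ := fun i => if hi : i ∈ J then c ⟨i, hi⟩ else 0
  have hc' : ∑ i, c' i = 0 := by
    rw [← Finset.sum_subset (Finset.subset_univ J) (by intro k _ hk; simp [c', hk]),
      ← Finset.sum_coe_sort J]
    simpa [c'] using hc
  have hcx' : ∑ i, c' i • x i = 0 := by
    rw [← Finset.sum_subset (Finset.subset_univ J) (by intro k _ hk; simp [c', hk]),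
      ← Finset.sum_coe_sort J]
    simpa [c'] using hcx
  obtain ⟨r, hr⟩ := h.unique c' hc' hcx'
  have hr0 : r = 0 := by
    simpa [c', hi, hgi] using congrFun hr i
  ext j
  simpa [c', hr0] using congrFun hr j

section DecidableEq

variable [DecidableEq ι]

lemma mem_affineSpan_image_erase (h : IsAffineCircuit x g) {J : Finset ι}
    (hJ : ∀ k, g k ≠ 0 → k ∈ J) {i : ι} (hi : g i ≠ 0) :
    x i ∈ affineSpan ℝ (x '' (J.erase i : Finset ι)) := by
  have hsum : ∑ k ∈ J.erase i, -(g i)⁻¹ * g k = 1 := by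
    have hg : g i + ∑ k ∈ J.erase i, g k = 0 := by
      rw [Finset.add_sum_erase J g (hJ i hi), Finset.sum_subset (Finset.subset_univ J), h.sum_eq]
      exact fun k _ hk => by_contra fun e => hk (hJ k e)
    rw [← Finset.mul_sum, eq_neg_of_add_eq_zero_right hg]
    field_simp
  have hsmul : ∑ k ∈ J.erase i, (-(g i)⁻¹ * g k) • x k = x i := by
    have hgx : g i • x i + ∑ k ∈ J.erase i, g k • x k = 0 := by
      rw [Finset.add_sum_erase J (fun k => g k • x k) (hJ i hi),
        Finset.sum_subset (Finset.subset_univ J), h.sum_smul_eq]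
      exact fun k _ hk => by rw [by_contra fun e => hk (hJ k e), zero_smul]
    simp only [mul_smul, ← Finset.smul_sum]
    rw [eq_neg_of_add_eq_zero_right hgx, neg_smul, smul_neg, neg_neg, inv_smul_smul₀ hi]
  rw [← hsmul]
  exact sum_smul_mem_affineSpan hsum fun k hk =>
    subset_affineSpan ℝ _ (Set.mem_image_of_mem x (Finset.mem_coe.2 hk))

lemma affDim_image (h : IsAffineCircuit x g) (J : Finset ι) :
    affDim (x '' J) = circuitDim {i | 0 < g i} {i | g i < 0} J := by
  unfold circuitDim
  split_ifs with hJ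
  · have hsupp : ∀ k, g k ≠ 0 → k ∈ J := fun k hk => hJ (by
      rcases hk.lt_or_gt with hk | hk <;> simp [hk])
    obtain ⟨i, hi⟩ := h.exists_pos
    have hiJ := hsupp i hi.ne'
    have hinsert : x '' J = insert (x i) (x '' (J.erase i : Finset ι)) := by
      rw [← Set.image_insert_eq, ← Finset.coe_insert, Finset.insert_erase hiJ]
    rw [hinsert, affDim_congr
      (affineSpan_insert_eq_affineSpan ℝ (h.mem_affineSpan_image_erase hsupp hi.ne')),
      h.affDim_image_of_notMem (Finset.notMem_erase i J) hi.ne', Finset.card_erase_of_mem hiJ,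
      Nat.cast_sub (Finset.card_pos.2 ⟨i, hiJ⟩), Nat.cast_one]
  · obtain ⟨i, hi, hiJ⟩ := Finset.not_subset.1 hJ
    have hgi : g i ≠ 0 := by
      rcases Finset.mem_union.1 hi with hi | hi
      exacts [(Finset.mem_filter.1 hi).2.ne', (Finset.mem_filter.1 hi).2.ne]
    rw [h.affDim_image_of_notMem hiJ hgi, sub_zero]

end DecidableEq

lemma affDim_range (h : IsAffineCircuit x g) :
    affDim (Set.range x) = Fintype.card ι - 2 := by
  classical
  rw [← Set.image_univ, ← Finset.coe_univ, h.affDim_image]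
  simp only [circuitDim, Finset.card_univ, Finset.subset_univ, if_true]
  ring

end Module

variable [NormedAddCommGroup V] [NormedSpace ℝ V] {x : ι → V} {g : ι → ℝ}

lemma exists_functional (h : IsAffineCircuit x g) {y : ι → ℝ} (hy : ∑ i, g i * y i = 0) :
    ∃ (l : StrongDual ℝ V) (M : ℝ), ∀ i, M - l (x i) = y i := by
  classical
  let Ψ : (StrongDual ℝ V × ℝ) →ₗ[ℝ] (ι → ℝ) :=
    { toFun := fun p i => p.2 - p.1 (x i)
      map_add' := fun p q => by ext i; simp; ring
      map_smul' := fun r p => by ext i; simp; ring }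
  suffices hmem : y ∈ LinearMap.range Ψ by
    obtain ⟨⟨l, M⟩, rfl⟩ := hmem
    exact ⟨l, M, fun i => rfl⟩
  by_contra hmem
  obtain ⟨f, hf, hfy⟩ := exists_strongDual_of_notMem hmem 1
  let c : ι → ℝ := fun i => f (Pi.single i 1)
  have hfc : ∀ z : ι → ℝ, f z = ∑ i, c i * z i := fun z => by
    conv_lhs => rw [pi_eq_sum_univ' z]
    simp only [map_sum, map_smul, smul_eq_mul, c, mul_comm]
  have hc : ∑ i, c i = 0 := by
    simpa [hfc, Ψ] using hf _ ⟨(0, 1), rfl⟩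
  have hcx : ∑ i, c i • x i = 0 :=
    (SeparatingDual.eq_zero_iff_forall_dual_eq_zero (R := ℝ) _).2 fun l => by
      simpa [hfc, Ψ] using hf _ ⟨(l, 0), rfl⟩
  obtain ⟨r, hr⟩ := h.unique c hc hcx
  rw [hfc, hr] at hfy
  simp [mul_assoc, ← Finset.mul_sum, hy] at hfy

lemma sum_mul_sub_eq_zero (h : IsAffineCircuit x g) (l : StrongDual ℝ V) (M : ℝ) :
    ∑ i, g i * (M - l (x i)) = 0 := by
  have hgl : ∑ i, g i * l (x i) = 0 := by
    simpa using congrArg l h.sum_smul_eq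
  simp [mul_sub, Finset.sum_sub_distrib, hgl, ← Finset.sum_mul, h.sum_eq]

lemma one_lt_card_pos (h : IsAffineCircuit x g) {P : Set V} (hx : Function.Injective x)
    (hv : ∀ i, x i ∈ vertexSet P) : 1 < (Finset.univ.filter fun i => 0 < g i).card := by
  obtain ⟨i, hi⟩ := h.exists_pos
  obtain ⟨j, hj⟩ := h.exists_neg
  obtain ⟨l, hl⟩ := exists_lt_of_mem_vertexSet (hv i)
  have hlt : ∀ k ≠ i, 0 < l (x i) - l (x k) := fun k hk =>
    sub_pos.2 (hl _ (vertexSet_subset P (hv k)) (hx.ne hk))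
  have hji : j ≠ i := fun e => lt_asymm hi (e ▸ hj)
  obtain ⟨k, -, hk⟩ := Finset.exists_pos_of_sum_zero_of_exists_nonzero _
    (h.sum_mul_sub_eq_zero l (l (x i))) ⟨j, Finset.mem_univ j, mul_ne_zero hj.ne (hlt j hji).ne'⟩
  have hki : k ≠ i := fun e => by simp [e] at hk
  exact Finset.one_lt_card.2 ⟨i, by simpa using hi, k,
    by simpa using (pos_iff_pos_of_mul_pos hk).2 (hlt k hki), hki.symm⟩

variable [DecidableEq ι]

lemma isCircuitFace_iff (h : IsAffineCircuit x g) (J : Finset ι) :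
    IsCircuitFace {i | 0 < g i} {i | g i < 0} J ↔
      ∃ (l : StrongDual ℝ V) (M : ℝ), (∀ i, l (x i) ≤ M) ∧ ∀ i, l (x i) = M ↔ i ∈ J := by
  constructor
  · intro hJ
    obtain ⟨y, hy, hyJ, hgy⟩ := hJ.exists_nonneg
    obtain ⟨l, M, hl⟩ := h.exists_functional hgy
    refine ⟨l, M, fun i => by linarith [hl i, hy i], fun i => ?_⟩
    rw [← hyJ, ← hl i, sub_eq_zero, eq_comm]
  · rintro ⟨l, M, hl, hJ⟩
    exact IsCircuitFace.of_nonneg (fun i => sub_nonneg.2 (hl i))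
      (fun i => by rw [sub_eq_zero, eq_comm, hJ]) (h.sum_mul_sub_eq_zero l M)

lemma convexHull_image_mem_faceComplex (h : IsAffineCircuit x g) {J : Finset ι}
    (hJ : IsCircuitFace {i | 0 < g i} {i | g i < 0} J) :
    convexHull ℝ (x '' J) ∈ faceComplex (convexHull ℝ (Set.range x)) ∧
      ∀ i, x i ∈ convexHull ℝ (x '' J) ↔ i ∈ J := by
  obtain ⟨l, M, hl, hlJ⟩ := (h.isCircuitFace_iff J).1 hJ
  have hle : ∀ z ∈ Set.range x, l z ≤ M := by
    rintro _ ⟨i, rfl⟩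
    exact hl i
  have hlevel : {z ∈ Set.range x | l z = M} = x '' J := by
    ext z
    constructor
    · rintro ⟨⟨i, rfl⟩, hi⟩
      exact ⟨i, (hlJ i).1 hi, rfl⟩
    · rintro ⟨i, hi, rfl⟩
      exact ⟨⟨i, rfl⟩, (hlJ i).2 hi⟩
  rw [← hlevel, ← setOf_mem_convexHull_and_map_eq hle]
  refine ⟨level_mem_faceComplex fun z hz => le_of_mem_convexHull hle hz, fun i => ?_⟩
  rw [← hlJ i]
  exact ⟨fun hi => hi.2, fun hi => ⟨subset_convexHull ℝ _ ⟨i, rfl⟩, hi⟩⟩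

lemma exists_isCircuitFace (h : IsAffineCircuit x g) {F : Set V}
    (hF : F ∈ faceComplex (convexHull ℝ (Set.range x))) :
    ∃ J : Finset ι, IsCircuitFace {i | 0 < g i} {i | g i < 0} J ∧ F = convexHull ℝ (x '' J) := by
  classical
  rcases F.eq_empty_or_nonempty with rfl | hne
  · obtain ⟨i, hi⟩ := h.exists_pos
    obtain ⟨j, hj⟩ := h.exists_neg
    exact ⟨∅, iff_of_true ⟨i, by simp [hi]⟩ ⟨j, by simp [hj]⟩, by simp⟩
  · obtain ⟨l, M, hl, rfl⟩ := exists_level_of_mem_faceComplex hF hne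
    have hle : ∀ z ∈ Set.range x, l z ≤ M := fun z hz => hl z (subset_convexHull ℝ _ hz)
    refine ⟨Finset.univ.filter fun i => l (x i) = M, (h.isCircuitFace_iff _).2
      ⟨l, M, fun i => hle _ ⟨i, rfl⟩, by simp⟩, ?_⟩
    rw [setOf_mem_convexHull_and_map_eq hle]
    congr 1
    ext z
    simp only [Set.mem_ofPred_eq, Set.mem_range, Finset.coe_filter, Finset.mem_univ, true_and,
      Set.mem_image]
    grind

lemma ncard_faces (h : IsAffineCircuit x g) (d : ℤ) :
    {F | F ∈ faceComplex (convexHull ℝ (Set.range x)) ∧ affDim F = d}.ncard =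
      (Finset.univ.filter fun J : Finset ι => IsCircuitFace {i | 0 < g i} {i | g i < 0} J ∧
        circuitDim {i | 0 < g i} {i | g i < 0} J = d).card := by
  rw [← Set.ncard_coe_finset, ← Set.InjOn.ncard_image (f := fun J : Finset ι =>
    convexHull ℝ (x '' (J : Set ι)))]
  · congr 1
    ext F
    simp only [Set.mem_ofPred_eq, Finset.coe_filter, Finset.mem_univ, true_and, Set.mem_image]
    constructor
    · rintro ⟨hF, hd⟩
      obtain ⟨J, hJ, rfl⟩ := h.exists_isCircuitFace hF
      exact ⟨J, ⟨hJ, by rw [← hd, affDim_convexHull, h.affDim_image]⟩, rfl⟩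
    · rintro ⟨J, ⟨hJ, hd⟩, rfl⟩
      exact ⟨(h.convexHull_image_mem_faceComplex hJ).1, by
        rw [affDim_convexHull, h.affDim_image, hd]⟩
  · intro J hJ K hK hJK
    simp only [Finset.coe_filter, Finset.mem_univ, true_and, Set.mem_ofPred_eq] at hJ hK hJK
    ext i
    rw [← (h.convexHull_image_mem_faceComplex hJ.1).2,
      ← (h.convexHull_image_mem_faceComplex hK.1).2, hJK]

end IsAffineCircuit

end Circuit

section FVector

variable {V : Type*} [NormedAddCommGroup V] [NormedSpace ℝ V] {P : Set V}

-- In `fVector`, `List.range _ : List ℕ` is coerced to a `List ℤ` through the list monad.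
lemma fVector_eq_map (P : Set V) :
    fVector P = (List.range (affDim P + 2).toNat).map fun i : ℕ =>
      {F | F ∈ faceComplex P ∧ affDim F = (i : ℤ) - 1}.ncard := by
  unfold fVector
  simp only [List.bind_eq_flatMap, List.pure_def, List.map_flatMap, List.map_cons, List.map_nil]
  rw [← List.map_eq_flatMap]

lemma affDim_add_two_of_fVector {L : List ℕ} (h : fVector P = L) :
    (affDim P + 2).toNat = L.length := by
  simp [← h, fVector_eq_map]

lemma ncard_faces_of_fVector {L : List ℕ} (h : fVector P = L) {i : ℕ} (hi : i < L.length) :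
    {F | F ∈ faceComplex P ∧ affDim F = (i : ℤ) - 1}.ncard = L[i] := by
  subst h
  simp [fVector_eq_map]

lemma ncard_faces_affDim_zero [FiniteDimensional ℝ V] (P : Set V) :
    {F | F ∈ faceComplex P ∧ affDim F = 0}.ncard = (vertexSet P).ncard := by
  rw [← Set.ncard_image_of_injective (vertexSet P) Set.singleton_injective]
  congr 1
  ext F
  simp only [Set.mem_ofPred_eq, affDim_eq_zero_iff, Set.mem_image]
  constructor
  · rintro ⟨h, v, rfl⟩
    exact ⟨v, h, rfl⟩
  · rintro ⟨v, hv, rfl⟩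
    exact ⟨hv, v, rfl⟩

lemma ncard_vertexSet_of_fVector [FiniteDimensional ℝ V] {L : List ℕ} (h : fVector P = L)
    (hL : 1 < L.length) : (vertexSet P).ncard = L[1] := by
  rw [← ncard_faces_of_fVector h hL, ← ncard_faces_affDim_zero, Nat.cast_one, sub_self]

/-- The `f`-vector of a polytope on the vertices `ι` whose only affine dependency has positive and
negative supports `p` and `n`. -/
def circuitFVector {ι : Type*} [Fintype ι] [DecidableEq ι] (p n : Finset ι) : List ℕ :=
  (List.range (Fintype.card ι)).map fun d : ℕ =>
    (Finset.univ.filter fun J : Finset ι => IsCircuitFace p n J ∧ circuitDim p n J = d - 1).card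

lemma IsAffineCircuit.fVector_eq {ι : Type*} [Fintype ι] [DecidableEq ι] {x : ι → V} {g : ι → ℝ}
    (h : IsAffineCircuit x g) :
    fVector (convexHull ℝ (Set.range x)) = circuitFVector {i | 0 < g i} {i | g i < 0} := by
  rw [fVector_eq_map, affDim_convexHull, h.affDim_range, sub_add_cancel, Int.toNat_natCast]
  simp only [h.ncard_faces, circuitFVector]

lemma circuitFVector_fin_two (N : Finset (Fin 2)) (hN : 1 < N.card) :
    circuitFVector (Finset.univ.image Sum.inr : Finset (Fin 2 ⊕ Fin 2)) (N.image Sum.inl) =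
      [1, 4, 4, 1] := by
  revert N
  decide +kernel

lemma circuitFVector_fin_three (N : Finset (Fin 3)) (hN : 1 < N.card) :
    circuitFVector (Finset.univ.image Sum.inr : Finset (Fin 3 ⊕ Fin 2)) (N.image Sum.inl) ∈
      ({[1, 5, 9, 6, 1], [1, 5, 8, 5, 1]} : Set (List ℕ)) := by
  rw [Set.mem_insert_iff, Set.mem_singleton_iff]
  revert N
  decide +kernel

end FVector

section TwoCircuit

variable {V : Type*} [NormedAddCommGroup V] [NormedSpace ℝ V] {m : ℕ}

lemma affDim_simplex (s : Affine.Simplex ℝ V m) : affDim (Set.range s.points) = m := by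
  rw [affDim_of_nonempty (Set.range_nonempty _),
    s.independent.finrank_vectorSpan (Fintype.card_fin _)]

lemma affDim_basisPolytope [FiniteDimensional ℝ V] {P : Set V} (s : Affine.Simplex ℝ V m)
    (hs : Set.range s.points ⊆ P) : affDim (basisPolytope P s) = affDim P - m := by
  have hne : P.Nonempty := (Set.range_nonempty s.points).mono hs
  have hmap : vectorSpan ℝ ((vectorSpan ℝ (Set.range s.points)).mkQ '' P) =
      (vectorSpan ℝ P).map (vectorSpan ℝ (Set.range s.points)).mkQ :=
    (AffineMap.map_vectorSpan (vectorSpan ℝ (Set.range s.points)).mkQ.toAffineMap).symm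
  have hrank := finrank_map_add_finrank_inf_ker (vectorSpan ℝ (Set.range s.points)).mkQ
    (vectorSpan ℝ P)
  rw [Submodule.ker_mkQ, inf_eq_right.2 (vectorSpan_mono ℝ hs),
    s.independent.finrank_vectorSpan (Fintype.card_fin _)] at hrank
  rw [affDim_of_nonempty hne, basisPolytope, affDim_of_nonempty (hne.image _), hmap]
  omega

lemma IsPolytope.affDim_sUnion_avoidingComplex [FiniteDimensional ℝ V] {P : Set V}
    (hP : IsPolytope P) (s : Affine.Simplex ℝ V m) :
    affDim (⋃₀ avoidingComplex P s) = affDim (vertexSet P \ Set.range s.points) := by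
  apply le_antisymm
  · rw [← affDim_convexHull (vertexSet P \ _)]
    refine affDim_mono (Set.sUnion_subset fun F ⟨hF, hav⟩ => ?_)
    rw [hP.face_eq_convexHull hF]
    refine convexHull_mono fun y hy => ⟨hy.2, ?_⟩
    rintro ⟨i, rfl⟩
    exact hav i hy.1
  · exact affDim_mono fun y hy => ⟨{y}, ⟨hy.1, fun i e => hy.2 ⟨i, e⟩⟩, rfl⟩

lemma IsPolytope.isMeek_iff [FiniteDimensional ℝ V] {P : Set V} (hP : IsPolytope P)
    {s : Affine.Simplex ℝ V m} (hs : Set.range s.points ⊆ P) :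
    IsMeek P s ↔ affDim (vertexSet P \ Set.range s.points) = affDim P - m := by
  rw [IsMeek, affDim_basisPolytope s hs, affDim_affineSpan, hP.affDim_sUnion_avoidingComplex,
    eq_comm]

/-- Normal form of an `(m + 1)`-polytope with `m + 3` vertices whose affine dependency has exactly
two positive coefficients, those of the vertices `x (Sum.inr j)`. -/
structure IsTwoCircuit (x : Fin (m + 1) ⊕ Fin 2 → V) (g : Fin (m + 1) ⊕ Fin 2 → ℝ) : Prop
    extends IsAffineCircuit x g where
  pos : ∀ j, 0 < g (Sum.inr j)
  nonpos : ∀ i, g (Sum.inl i) ≤ 0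
  injective : Function.Injective x
  mem_vertexSet : ∀ k, x k ∈ vertexSet (convexHull ℝ (Set.range x))

namespace IsTwoCircuit

variable {x : Fin (m + 1) ⊕ Fin 2 → V} {g : Fin (m + 1) ⊕ Fin 2 → ℝ}

lemma filter_pos (h : IsTwoCircuit x g) :
    Finset.univ.filter (fun i => 0 < g i) = Finset.univ.image Sum.inr := by
  ext (i | j)
  · simpa using h.nonpos i
  · simpa using h.pos j

lemma filter_neg (h : IsTwoCircuit x g) : Finset.univ.filter (fun i => g i < 0) =
    (Finset.univ.filter fun i => g (Sum.inl i) < 0).image Sum.inl := by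
  ext (i | j)
  · simp
  · simpa using (h.pos j).le

lemma one_lt_card_neg (h : IsTwoCircuit x g) :
    1 < (Finset.univ.filter fun i => g (Sum.inl i) < 0).card := by
  have hcard := h.neg.one_lt_card_pos h.injective h.mem_vertexSet
  simp only [Pi.neg_apply, neg_pos] at hcard
  rwa [h.filter_neg, Finset.card_image_of_injective _ Sum.inl_injective] at hcard

lemma fVector_eq_of_one {x : Fin 2 ⊕ Fin 2 → V} {g : Fin 2 ⊕ Fin 2 → ℝ}
    (h : IsTwoCircuit (m := 1) x g) : fVector (convexHull ℝ (Set.range x)) = [1, 4, 4, 1] := by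
  rw [h.fVector_eq, h.filter_pos, h.filter_neg]
  exact circuitFVector_fin_two _ h.one_lt_card_neg

lemma fVector_mem_of_two {x : Fin 3 ⊕ Fin 2 → V} {g : Fin 3 ⊕ Fin 2 → ℝ}
    (h : IsTwoCircuit (m := 2) x g) : fVector (convexHull ℝ (Set.range x)) ∈
      ({[1, 5, 9, 6, 1], [1, 5, 8, 5, 1]} : Set (List ℕ)) := by
  rw [h.fVector_eq, h.filter_pos, h.filter_neg]
  exact circuitFVector_fin_three _ h.one_lt_card_neg

lemma affDim_eq (h : IsTwoCircuit x g) : affDim (convexHull ℝ (Set.range x)) = (m + 1 : ℕ) := by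
  rw [affDim_convexHull, h.affDim_range]
  simp

lemma exists_simplex (h : IsTwoCircuit x g) :
    ∃ s : Affine.Simplex ℝ V m, ∀ i, s.points i = x (Sum.inl i) := by
  refine ⟨⟨fun i => x (Sum.inl i), ?_⟩, fun i => rfl⟩
  have hdim := h.affDim_image_of_notMem (J := Finset.univ.image Sum.inl) (i := Sum.inr 0)
    (by simp) (h.pos 0).ne'
  have himage : x '' (Finset.univ.image Sum.inl : Finset (Fin (m + 1) ⊕ Fin 2)) =
      Set.range fun i => x (Sum.inl i) := by
    ext
    simp
  rw [himage, affDim_of_nonempty (Set.range_nonempty _),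
    Finset.card_image_of_injective _ Sum.inl_injective, Finset.card_univ, Fintype.card_fin] at hdim
  exact (affineIndependent_iff_finrank_vectorSpan_eq ℝ _ (Fintype.card_fin _)).2 (by omega)

lemma card_inl_of_isCircuitFace (h : IsTwoCircuit x g) {J : Finset (Fin (m + 1) ⊕ Fin 2)}
    (hJ : IsCircuitFace {i | 0 < g i} {i | g i < 0} J)
    (hd : circuitDim {i | 0 < g i} {i | g i < 0} J = m) :
    (Finset.univ.filter fun i => Sum.inl i ∈ J).card = m := by
  have hcard : J.card = (Finset.univ.filter fun i => Sum.inl i ∈ J).card +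
      (Finset.univ.filter fun j => Sum.inr j ∈ J).card := by
    rw [← Finset.card_toLeft_add_card_toRight (u := J)]
    congr 2 <;> ext <;> simp
  by_cases hsub : Finset.univ.filter (fun i => 0 < g i) ∪ Finset.univ.filter (fun i => g i < 0) ⊆ J
  · have hright : Finset.univ.filter (fun j => Sum.inr j ∈ J) = Finset.univ :=
      Finset.filter_true_of_mem fun j _ => hsub (by simp [h.pos j])
    rw [circuitDim, if_pos hsub, hcard, hright, Finset.card_univ, Fintype.card_fin] at hd
    push_cast at hd
    omega
  · obtain ⟨k, hk, hkJ⟩ := Finset.not_subset.1 hsub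
    have hneg : ∃ i ∈ Finset.univ.filter (fun i => g i < 0), i ∉ J :=
      (Finset.mem_union.1 hk).elim (fun hk => hJ.1 ⟨k, hk, hkJ⟩) fun hk => ⟨k, hk, hkJ⟩
    have hpos := hJ.2 hneg
    rw [h.filter_neg, Finset.exists_mem_image] at hneg
    rw [h.filter_pos, Finset.exists_mem_image] at hpos
    obtain ⟨i, -, hi⟩ := hneg
    obtain ⟨j, -, hj⟩ := hpos
    rw [circuitDim, if_neg hsub, hcard] at hd
    have hleft : (Finset.univ.filter fun i => Sum.inl i ∈ J).card < Fintype.card (Fin (m + 1)) :=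
      Finset.card_lt_univ_of_notMem (x := i) (by simpa using hi)
    have hright : (Finset.univ.filter fun j => Sum.inr j ∈ J).card < Fintype.card (Fin 2) :=
      Finset.card_lt_univ_of_notMem (x := j) (by simpa using hj)
    rw [Fintype.card_fin] at hleft hright
    push_cast at hd
    omega

lemma isSpecialSimplex (h : IsTwoCircuit x g) {s : Affine.Simplex ℝ V m}
    (hs : ∀ i, s.points i = x (Sum.inl i)) : IsSpecialSimplex (convexHull ℝ (Set.range x)) s := by
  refine ⟨fun i => hs i ▸ h.mem_vertexSet _, ?_⟩
  rintro F ⟨hF, hd⟩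
  obtain ⟨J, hJ, rfl⟩ := h.exists_isCircuitFace hF
  rw [h.affDim_eq, affDim_convexHull, h.affDim_image, Nat.cast_succ, add_sub_cancel_right] at hd
  refine Eq.trans ?_ (h.card_inl_of_isCircuitFace hJ hd)
  rw [← Set.ncard_coe_finset]
  congr 1
  ext i
  simp [hs, (h.convexHull_image_mem_faceComplex hJ).2]

lemma isMeek [FiniteDimensional ℝ V] (h : IsTwoCircuit x g) {s : Affine.Simplex ℝ V m}
    (hs : ∀ i, s.points i = x (Sum.inl i)) : IsMeek (convexHull ℝ (Set.range x)) s := by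
  have hrange : Set.range s.points = Set.range (x ∘ Sum.inl) := congrArg Set.range (funext hs)
  have hvertex : vertexSet (convexHull ℝ (Set.range x)) = Set.range x :=
    (vertexSet_convexHull_subset _).antisymm (Set.range_subset_iff.2 h.mem_vertexSet)
  have hrest : Set.range x \ Set.range (x ∘ Sum.inl) = {x (Sum.inr 0), x (Sum.inr 1)} := by
    ext y
    constructor
    · rintro ⟨⟨i | j, rfl⟩, hy⟩
      · exact absurd ⟨i, rfl⟩ hy
      · fin_cases j <;> simp
    · rintro (rfl | rfl) <;> simp [h.injective.eq_iff]
  have hsub : Set.range s.points ⊆ convexHull ℝ (Set.range x) := by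
    rw [hrange]
    exact (Set.range_comp_subset_range _ _).trans (subset_convexHull ℝ _)
  rw [(isPolytope_convexHull (Set.finite_range x)).isMeek_iff hsub, hvertex, hrange, hrest,
    affDim_pair (h.injective.ne (by simp)), h.affDim_eq]
  push_cast
  ring

lemma mem_meekPolytopes [FiniteDimensional ℝ V] (h : IsTwoCircuit x g) :
    convexHull ℝ (Set.range x) ∈ meekPolytopes V (m + 1) m := by
  obtain ⟨s, hs⟩ := h.exists_simplex
  exact ⟨isPolytope_convexHull (Set.finite_range x), h.affDim_eq, s, h.isSpecialSimplex hs,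
    h.isMeek hs⟩

end IsTwoCircuit

end TwoCircuit

section SpecialSimplex

lemma exists_eq_sum_smul_add_smul {V ι : Type*} [AddCommGroup V] [Module ℝ V] [Fintype ι]
    {p : ι → V} {y z : V} (hy : y ∈ affineSpan ℝ (insert z (Set.range p))) :
    ∃ (c : ι → ℝ) (d : ℝ), ∑ i, c i + d = 1 ∧ y = ∑ i, c i • p i + d • z := by
  rw [← Option.range_elim] at hy
  obtain ⟨w, hw, rfl⟩ := eq_affineCombination_of_mem_affineSpan_of_fintype hy
  refine ⟨fun i => w (some i), w none, ?_, ?_⟩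
  · rw [← hw, Fintype.sum_option, add_comm]
  · rw [Finset.affineCombination_eq_linear_combination _ _ _ hw, Fintype.sum_option, add_comm]
    rfl

lemma sum_smul_add_smul_mem_convexHull {V ι : Type*} [AddCommGroup V] [Module ℝ V] [Fintype ι]
    {p : ι → V} {z : V} {c : ι → ℝ} {d : ℝ} (hc : ∀ i, 0 ≤ c i) (hd : 0 ≤ d)
    (hcd : ∑ i, c i + d = 1) :
    ∑ i, c i • p i + d • z ∈ convexHull ℝ (insert z (Set.range p)) := by
  rw [← Option.range_elim]
  refine mem_convexHull_of_exists_fintype (fun o : Option ι => o.elim d c) _ ?_ ?_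
    Set.mem_range_self ?_
  · rintro (_ | i)
    exacts [hd, hc i]
  · simp [Fintype.sum_option, ← hcd, add_comm]
  · simp [Fintype.sum_option, add_comm]

lemma exists_sum_smul_of_mem_convexHull_range {V ι : Type*} [AddCommGroup V] [Module ℝ V]
    [Fintype ι] {p : ι → V} {y : V} (hy : y ∈ convexHull ℝ (Set.range p)) :
    ∃ c : ι → ℝ, (∀ i, 0 ≤ c i) ∧ ∑ i, c i = 1 ∧ ∑ i, c i • p i = y := by
  classical
  have hrange : Set.range p =
      Fintype.linearCombination ℝ p '' Set.range fun i j : ι => if i = j then (1 : ℝ) else 0 := by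
    rw [← Set.range_comp]
    congr 1
    ext i
    simp [Fintype.linearCombination_apply]
  rw [hrange, ← LinearMap.image_convexHull, convexHull_basis_eq_stdSimplex] at hy
  obtain ⟨c, ⟨hc, hc1⟩, rfl⟩ := hy
  exact ⟨c, hc, hc1, rfl⟩

variable {V : Type*} [NormedAddCommGroup V] [NormedSpace ℝ V] {P : Set V} {m : ℕ}
  {s : Affine.Simplex ℝ V m}

namespace IsSpecialSimplex

lemma range_subset (hs : IsSpecialSimplex P s) : Set.range s.points ⊆ P := by
  rintro _ ⟨i, rfl⟩
  exact vertexSet_subset P (hs.1 i)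

lemma mem_of_ne (hs : IsSpecialSimplex P s) {F : Set V} (hF : F ∈ facets P) {i j : Fin (m + 1)}
    (hi : s.points i ∉ F) (hj : j ≠ i) : s.points j ∈ F := by
  have hcard := Set.ncard_add_ncard_compl {i | s.points i ∈ F}
  rw [hs.2 F hF, Nat.card_eq_fintype_card, Fintype.card_fin, add_right_inj,
    Set.ncard_eq_one] at hcard
  obtain ⟨k, hk⟩ := hcard
  by_contra hjF
  have hik : i = k := hk.subset hi
  have hjk : j = k := hk.subset hjF
  exact hj (hjk.trans hik.symm)

lemma mem_of_coeff_neg (hs : IsSpecialSimplex P s) {F : Set V} (hF : F ∈ facets P) {z : V}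
    (hz : z ∈ F) {c : Fin (m + 1) → ℝ} {d : ℝ} (hcd : ∑ i, c i + d = 1)
    (hP : ∑ i, c i • s.points i + d • z ∈ P) {i : Fin (m + 1)} (hi : c i < 0) :
    s.points i ∈ F := by
  by_contra hiF
  obtain ⟨l, M, hl, rfl⟩ := exists_level_of_mem_faceComplex hF.1 ⟨z, hz⟩
  have hlt : l (s.points i) < M := (hl _ (hs.range_subset ⟨i, rfl⟩)).lt_of_ne fun e =>
    hiF ⟨hs.range_subset ⟨i, rfl⟩, e⟩
  have hsum : ∑ j, c j * (l (s.points j) - M) = c i * (l (s.points i) - M) :=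
    Fintype.sum_eq_single i fun j hj => by rw [(hs.mem_of_ne hF hiF hj).2, sub_self, mul_zero]
  have hle := hl _ hP
  simp only [map_add, map_sum, map_smul, smul_eq_mul, hz.2] at hle
  simp only [mul_sub, Finset.sum_sub_distrib, ← Finset.sum_mul] at hsum
  have hM : (∑ j, c j) * M + d * M = M := by rw [← add_mul, hcd, one_mul]
  linarith [mul_pos_of_neg_of_neg hi (sub_neg.2 hlt)]

variable [FiniteDimensional ℝ V]

lemma eq_of_level (hs : IsSpecialSimplex P s) (hP : IsPolytope P) {l : StrongDual ℝ V} {M : ℝ}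
    (hl : ∀ y ∈ P, l y ≤ M) (hv : ∀ i, l (s.points i) = M) : ∀ y ∈ P, l y = M := by
  intro y hy
  by_contra hne
  obtain ⟨F, hF, -, hF'⟩ :=
    hP.exists_facet_notMem hl ⟨_, hs.range_subset ⟨0, rfl⟩, hv 0⟩ hy hne
  have hcard := hs.2 F hF
  have huniv : {i | s.points i ∈ F} = Set.univ :=
    Set.eq_univ_of_forall fun i => hF' _ (hs.range_subset ⟨i, rfl⟩) (hv i)
  rw [huniv, Set.ncard_univ, Nat.card_eq_fintype_card, Fintype.card_fin] at hcard
  omega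

lemma coeff_nonneg (hs : IsSpecialSimplex P s) (hP : IsPolytope P) {h : StrongDual ℝ V} {M : ℝ}
    (hv : ∀ i, h (s.points i) = M) {z : V} (hz : z ∈ P) (hmax : ∀ y ∈ P, h y ≤ h z)
    (hlt : M < h z) {c : Fin (m + 1) → ℝ} {d : ℝ} (hcd : ∑ i, c i + d = 1)
    (hy : ∑ i, c i • s.points i + d • z ∈ P) (i : Fin (m + 1)) : 0 ≤ c i := by
  by_contra! hi
  obtain ⟨ε, hε, hext⟩ := hP.exists_extend hz (hs.range_subset ⟨i, rfl⟩) fun F hF hzF =>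
    hs.mem_of_coeff_neg hF hzF hcd hy hi
  have hle := hmax _ hext
  simp only [map_add, map_smul, map_sub, smul_eq_mul, hv] at hle
  linarith [mul_pos hε (sub_pos.2 hlt)]

lemma mem_convexHull_insert (hs : IsSpecialSimplex P s) (hP : IsPolytope P)
    (hd : affDim P = m + 1) {h : StrongDual ℝ V} {M : ℝ} (hv : ∀ i, h (s.points i) = M) {z : V}
    (hz : z ∈ P) (hmax : ∀ y ∈ P, h y ≤ h z) (hlt : M < h z) {y : V} (hy : y ∈ P) (hyM : M ≤ h y) :
    y ∈ convexHull ℝ (insert z (Set.range s.points)) := by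
  have hzn : z ∉ affineSpan ℝ (Set.range s.points) := fun hz =>
    hlt.ne' (map_eq_of_mem_affineSpan (Set.forall_mem_range.2 hv) hz)
  have hspan : affineSpan ℝ (insert z (Set.range s.points)) = affineSpan ℝ P :=
    affineSpan_eq_of_affDim_le (Set.insert_subset hz hs.range_subset) (Set.insert_nonempty _ _)
      (by rw [affDim_insert_of_notMem hzn, affDim_simplex, hd])
  obtain ⟨c, d, hcd, rfl⟩ := exists_eq_sum_smul_add_smul (hspan ▸ subset_affineSpan ℝ P hy)
  refine sum_smul_add_smul_mem_convexHull (hs.coeff_nonneg hP hv hz hmax hlt hcd hy) ?_ hcd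
  simp only [map_add, map_sum, map_smul, smul_eq_mul, hv, ← Finset.sum_mul] at hyM
  rw [eq_sub_of_add_eq hcd] at hyM
  exact nonneg_of_mul_nonneg_left (by linarith : 0 ≤ d * (h z - M)) (sub_pos.2 hlt)

lemma exists_height (hs : IsSpecialSimplex P s) (hP : IsPolytope P) (hd : affDim P = m + 1) :
    ∃ (h : StrongDual ℝ V) (M : ℝ), (∀ i, h (s.points i) = M) ∧
      ∃ z ∈ vertexSet P, ∃ w ∈ vertexSet P, (∀ y ∈ P, h y ≤ h z) ∧ (∀ y ∈ P, h w ≤ h y) ∧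
        M < h z ∧ h w < M := by
  obtain ⟨y, hy, hyn⟩ : ∃ y ∈ P, y ∉ affineSpan ℝ (Set.range s.points) := by
    by_contra! hn
    have hle := affDim_mono (show P ⊆ affineSpan ℝ (Set.range s.points) from hn)
    rw [affDim_affineSpan, affDim_simplex] at hle
    omega
  obtain ⟨h, M, hv, hhy⟩ :=
    exists_strongDual_of_notMem_affineSpan (Set.range_nonempty s.points) hyn 1
  replace hv : ∀ i, h (s.points i) = M := fun i => hv _ (mem_affineSpan ℝ ⟨i, rfl⟩)
  obtain ⟨z, hz, hmax⟩ := hP.exists_max ⟨y, hy⟩ h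
  obtain ⟨w, hw, hmin⟩ := hP.exists_max ⟨y, hy⟩ (-h)
  simp only [neg_apply, neg_le_neg_iff] at hmin
  refine ⟨h, M, hv, z, hz, w, hw, hmax, hmin, by linarith [hmax y hy], ?_⟩
  by_contra! hn
  have heq := hs.eq_of_level hP (l := -h) (M := -M)
    (fun y hy => neg_le_neg (hn.trans (hmin y hy))) (fun i => congrArg Neg.neg (hv i)) y hy
  have hhy' : h y = M := neg_inj.1 heq
  linarith

lemma exists_combo_mem_convexHull (hs : IsSpecialSimplex P s) (hP : IsPolytope P)
    (hd : affDim P = m + 1) {h : StrongDual ℝ V} {M : ℝ} (hv : ∀ i, h (s.points i) = M) {z w : V}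
    (hz : z ∈ P) (hw : w ∈ P) (hmax : ∀ y ∈ P, h y ≤ h z) (hzlt : M < h z) (hwlt : h w < M) :
    ∃ α : ℝ, 0 < α ∧ α < 1 ∧
      α • z + (1 - α) • w ∈ convexHull ℝ (Set.range s.points) := by
  have hden : 0 < h z - h w := by linarith
  set α := (M - h w) / (h z - h w)
  have hα0 : 0 < α := div_pos (sub_pos.2 hwlt) hden
  have hα1 : α < 1 := (div_lt_one hden).2 (by linarith)
  have hαM : α * (h z - h w) = M - h w := div_mul_cancel₀ _ hden.ne'
  have hheight : h (α • z + (1 - α) • w) = M := by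
    simp only [map_add, map_smul, smul_eq_mul]
    linarith
  have hle : ∀ y ∈ insert z (Set.range s.points), (-h) y ≤ -M := by
    rintro _ (rfl | ⟨i, rfl⟩)
    exacts [neg_le_neg hzlt.le, (congrArg Neg.neg (hv i)).le]
  have hmem := setOf_mem_convexHull_and_map_eq hle ▸ Set.mem_sep
    (hs.mem_convexHull_insert hP hd hv hz hmax hzlt
      (hP.convex hz hw hα0.le (sub_pos.2 hα1).le (by ring)) hheight.ge)
    (congrArg Neg.neg hheight)
  refine ⟨α, hα0, hα1, convexHull_mono ?_ hmem⟩
  rintro _ ⟨rfl | hy, hyM⟩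
  exacts [absurd (neg_inj.1 hyM) hzlt.ne', hy]

lemma eq_convexHull (hs : IsSpecialSimplex P s) (hP : IsPolytope P)
    (hd : affDim P = m + 1) {h : StrongDual ℝ V} {M : ℝ} (hv : ∀ i, h (s.points i) = M) {z w : V}
    (hz : z ∈ P) (hw : w ∈ P) (hmax : ∀ y ∈ P, h y ≤ h z) (hmin : ∀ y ∈ P, h w ≤ h y)
    (hzlt : M < h z) (hwlt : h w < M) : P = convexHull ℝ (Set.range s.points ∪ {z, w}) := by
  refine Set.Subset.antisymm (fun y hy => ?_)
    (convexHull_min (Set.union_subset hs.range_subset (Set.pair_subset hz hw)) hP.convex)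
  rcases le_total M (h y) with hle | hle
  · exact convexHull_mono (Set.insert_subset (by simp) Set.subset_union_left)
      (hs.mem_convexHull_insert hP hd hv hz hmax hzlt hy hle)
  · exact convexHull_mono (Set.insert_subset (by simp) Set.subset_union_left)
      (hs.mem_convexHull_insert hP hd (h := -h) (fun i => congrArg Neg.neg (hv i)) hw
        (fun y hy => neg_le_neg (hmin y hy)) (neg_lt_neg hwlt) hy (neg_le_neg hle))

lemma exists_isTwoCircuit (hs : IsSpecialSimplex P s) (hP : IsPolytope P)
    (hd : affDim P = m + 1) :
    ∃ (x : Fin (m + 1) ⊕ Fin 2 → V) (g : Fin (m + 1) ⊕ Fin 2 → ℝ), IsTwoCircuit x g ∧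
      P = convexHull ℝ (Set.range x) := by
  obtain ⟨h, M, hv, z, hz, w, hw, hmax, hmin, hzlt, hwlt⟩ := hs.exists_height hP hd
  have hzP := vertexSet_subset P hz
  have hwP := vertexSet_subset P hw
  obtain ⟨α, hα0, hα1, hα⟩ := hs.exists_combo_mem_convexHull hP hd hv hzP hwP hmax hzlt hwlt
  obtain ⟨c, hc, hc1, hcα⟩ := exists_sum_smul_of_mem_convexHull_range hα
  let x : Fin (m + 1) ⊕ Fin 2 → V := Sum.elim s.points ![z, w]
  let g : Fin (m + 1) ⊕ Fin 2 → ℝ := Sum.elim (-c) ![α, 1 - α]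
  have hPx : P = convexHull ℝ (Set.range x) := by
    rw [Set.Sum.elim_range, Matrix.range_cons_cons_empty]
    exact hs.eq_convexHull hP hd hv hzP hwP hmax hmin hzlt hwlt
  have hgx : ∑ k, g k • x k = 0 := by simp [g, x, Fintype.sum_sum_type, hcα]
  obtain ⟨g', hg'⟩ := exists_isAffineCircuit (x := x) <| by
    rw [← affDim_convexHull, ← hPx, hd]
    simp
  refine ⟨x, g, ⟨hg'.of_dependency (by simp [g, Fintype.sum_sum_type, hc1]) hgx fun e => ?_,
    ?_, fun i => neg_nonpos.2 (hc i), ?_, ?_⟩, hPx⟩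
  · exact hα0.ne' (congrFun e (Sum.inr 0))
  · exact Fin.forall_fin_two.2 ⟨hα0, sub_pos.2 hα1⟩
  · refine s.independent.injective.sumElim (injective_pair_iff_ne.2 ?_)
      fun i => Fin.forall_fin_two.2 ⟨?_, ?_⟩
    · rintro rfl
      exact lt_asymm hzlt hwlt
    · exact fun e => hzlt.ne' ((congrArg h e).symm.trans (hv i))
    · exact fun e => hwlt.ne ((congrArg h e).symm.trans (hv i))
  · rw [← hPx]
    rintro (i | j)
    · exact hs.1 i
    · exact (Fin.forall_fin_two (p := fun j => ![z, w] j ∈ vertexSet P)).2 ⟨hz, hw⟩ j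

end IsSpecialSimplex

lemma IsAffineCircuit.comp_equiv {V ι κ : Type*} [AddCommGroup V] [Module ℝ V] [Fintype ι]
    [Fintype κ] {x : ι → V} {g : ι → ℝ} (h : IsAffineCircuit x g) (e : κ ≃ ι) :
    IsAffineCircuit (x ∘ e) (g ∘ e) where
  sum_eq := (Equiv.sum_comp e g).trans h.sum_eq
  sum_smul_eq := (Equiv.sum_comp e fun i => g i • x i).trans h.sum_smul_eq
  ne_zero := fun h0 => h.ne_zero (e.surjective.injective_comp_right h0)
  unique c hc hc' := by
    obtain ⟨r, hr⟩ := h.unique (c ∘ e.symm) ((Equiv.sum_comp e.symm c).trans hc) (by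
      rw [← Equiv.sum_comp e]
      simpa using hc')
    refine ⟨r, funext fun k => ?_⟩
    simpa using congrFun hr (e k)

lemma IsAffineCircuit.exists_card_pos_eq_two {ι : Type*} [Fintype ι] {x : ι → V} {g : ι → ℝ}
    (h : IsAffineCircuit x g) (hx : Function.Injective x) (hv : ∀ i, x i ∈ vertexSet P)
    (hcard : Fintype.card ι ≤ 5) :
    ∃ c, IsAffineCircuit x c ∧ (Finset.univ.filter fun i => 0 < c i).card = 2 := by
  classical
  have hpos := h.one_lt_card_pos hx hv
  have hneg := h.neg.one_lt_card_pos hx hv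
  have hdisj : Disjoint (Finset.univ.filter fun i => 0 < g i)
      (Finset.univ.filter fun i => 0 < (-g) i) :=
    Finset.disjoint_filter.2 fun i _ hi => by simpa using hi.le
  have hle := Finset.card_le_univ (Finset.univ.filter (fun i => 0 < g i) ∪
    Finset.univ.filter fun i => 0 < (-g) i)
  rw [Finset.card_union_of_disjoint hdisj] at hle
  by_cases htwo : (Finset.univ.filter fun i => 0 < g i).card = 2
  · exact ⟨g, h, htwo⟩
  · exact ⟨-g, h.neg, by omega⟩

lemma exists_equiv_fin_sum_fin {ι : Type*} [Fintype ι] {p : ι → Prop} [DecidablePred p] {k l : ℕ}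
    (hl : (Finset.univ.filter p).card = l) (hcard : Fintype.card ι = k + l) :
    ∃ e : Fin k ⊕ Fin l ≃ ι, (∀ i, ¬ p (e (Sum.inl i))) ∧ ∀ j, p (e (Sum.inr j)) := by
  have hp : Fintype.card {i // p i} = l := by rw [Fintype.card_subtype, hl]
  have hnp : Fintype.card {i // ¬ p i} = k := by
    rw [Fintype.card_subtype_compl, hp, hcard, Nat.add_sub_cancel]
  let e₁ := Fintype.equivFinOfCardEq hp
  let e₂ := Fintype.equivFinOfCardEq hnp
  exact ⟨((Equiv.sumCongr e₂.symm e₁.symm).trans (Equiv.sumComm _ _)).trans (Equiv.sumCompl p),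
    fun i => (e₂.symm i).2, fun j => (e₁.symm j).2⟩

lemma IsPolytope.exists_isTwoCircuit (hP : IsPolytope P) (hd : affDim P = m + 1)
    (hcard : (vertexSet P).ncard = m + 3) (hm : m ≤ 2) :
    ∃ (x : Fin (m + 1) ⊕ Fin 2 → V) (g : Fin (m + 1) ⊕ Fin 2 → ℝ), IsTwoCircuit x g ∧
      P = convexHull ℝ (Set.range x) := by
  have : Fintype (vertexSet P) := hP.finite_vertexSet.fintype
  rw [← Nat.card_coe_set_eq, Nat.card_eq_fintype_card] at hcard
  have : Nonempty (vertexSet P) := Fintype.card_pos_iff.1 (by omega)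
  have hdim : affDim (Set.range ((↑) : vertexSet P → V)) = Fintype.card (vertexSet P) - 2 := by
    rw [Subtype.range_val, hP.affDim_vertexSet, hd, hcard]
    push_cast
    ring
  obtain ⟨g₀, hg₀⟩ := exists_isAffineCircuit hdim
  obtain ⟨g, hg, hg2⟩ :=
    hg₀.exists_card_pos_eq_two Subtype.val_injective (fun i => i.2) (hcard ▸ by omega)
  obtain ⟨e, hinl, hinr⟩ := exists_equiv_fin_sum_fin (k := m + 1) hg2 (by omega)
  have hrange : P = convexHull ℝ (Set.range (Subtype.val ∘ e)) := by
    rw [e.surjective.range_comp, Subtype.range_val, hP.convexHull_vertexSet]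
  exact ⟨_, _, ⟨hg.comp_equiv e, hinr, fun i => not_lt.1 (hinl i),
    Subtype.val_injective.comp e.injective, fun k => hrange ▸ (e k).2⟩, hrange⟩

lemma meekPolytopes_subset_specialPolytopes {V : Type*} [NormedAddCommGroup V] [NormedSpace ℝ V]
    (n m : ℕ) : meekPolytopes V n m ⊆ specialPolytopes V n m :=
  fun _ ⟨hP, hd, s, hs, _⟩ => ⟨hP, hd, s, hs⟩

variable [FiniteDimensional ℝ V]

lemma specialPolytopes_eq_meekPolytopes (m : ℕ) :
    specialPolytopes V (m + 1) m = meekPolytopes V (m + 1) m := by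
  refine Set.Subset.antisymm ?_ (meekPolytopes_subset_specialPolytopes _ _)
  rintro P ⟨hP, hd, s, hs⟩
  obtain ⟨x, g, h, rfl⟩ := hs.exists_isTwoCircuit hP (mod_cast hd)
  exact h.mem_meekPolytopes

lemma IsPolytope.mem_meekPolytopes (hP : IsPolytope P) (hd : affDim P = m + 1)
    (hcard : (vertexSet P).ncard = m + 3) (hm : m ≤ 2) : P ∈ meekPolytopes V (m + 1) m := by
  obtain ⟨x, g, h, rfl⟩ := hP.exists_isTwoCircuit hd hcard hm
  exact h.mem_meekPolytopes

lemma meekPolytopes_two_one :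
    meekPolytopes V 2 1 = {P | IsPolytope P ∧ fVector P = [1, 4, 4, 1]} := by
  refine Set.Subset.antisymm ?_ ?_
  · rintro P ⟨hP, hd, s, hs, -⟩
    obtain ⟨x, g, h, rfl⟩ := hs.exists_isTwoCircuit hP hd
    exact ⟨hP, h.fVector_eq_of_one⟩
  · rintro P ⟨hP, hf⟩
    have hlength := affDim_add_two_of_fVector hf
    rw [List.length_cons] at hlength
    exact hP.mem_meekPolytopes (by simp at hlength; omega)
      (ncard_vertexSet_of_fVector hf (by simp)) one_le_two

lemma meekPolytopes_three_two : meekPolytopes V 3 2 =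
    {P | IsPolytope P ∧ (fVector P = [1, 5, 9, 6, 1] ∨ fVector P = [1, 5, 8, 5, 1])} := by
  refine Set.Subset.antisymm ?_ ?_
  · rintro P ⟨hP, hd, s, hs, -⟩
    obtain ⟨x, g, h, rfl⟩ := hs.exists_isTwoCircuit hP hd
    exact ⟨hP, h.fVector_mem_of_two⟩
  · rintro P ⟨hP, hf⟩
    have hlength : (affDim P + 2).toNat = 5 :=
      hf.elim affDim_add_two_of_fVector affDim_add_two_of_fVector
    have hcard : (vertexSet P).ncard = 5 :=
      hf.elim (fun hf => ncard_vertexSet_of_fVector hf (by simp))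
        fun hf => ncard_vertexSet_of_fVector hf (by simp)
    exact hP.mem_meekPolytopes (by omega) hcard le_rfl

end SpecialSimplex

section Polygon

variable {V : Type*} [NormedAddCommGroup V] [NormedSpace ℝ V] {P : Set V}

lemma ncard_faces_affDim_neg_one (P : Set V) :
    {F | F ∈ faceComplex P ∧ affDim F = -1}.ncard = 1 := by
  refine Set.ncard_eq_one.2 ⟨∅, ?_⟩
  ext F
  simp only [Set.mem_ofPred_eq, affDim_eq_neg_one_iff, Set.mem_singleton_iff]
  exact ⟨fun h => h.2, fun h => ⟨h ▸ isExposed_empty, h⟩⟩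

/-- The one-dimensional faces of `P`. -/
def edges (P : Set V) : Set (Set V) := {E | E ∈ faceComplex P ∧ affDim E = 1}

lemma edges_eq_facets (hd : affDim P = 2) : edges P = facets P := by
  simp [edges, facets, hd]

lemma IsPolytope.finite_edges (hP : IsPolytope P) : (edges P).Finite :=
  hP.finite_faceComplex.subset fun _ hE => hE.1

lemma linearIndependent_of_map_neg {W : Type*} [AddCommGroup W] [Module ℝ W] {d : Fin 3 → W}
    {k : Fin 3 → W →ₗ[ℝ] ℝ} (hzero : ∀ i, k i (d i) = 0) (hneg : ∀ i j, i ≠ j → k i (d j) < 0) :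
    LinearIndependent ℝ d := by
  have hdet : (Matrix.of fun i j => k i (d j)).det ≠ 0 := by
    have hcycle₁ : k 0 (d 1) * k 1 (d 2) * k 2 (d 0) < 0 := mul_neg_of_pos_of_neg
      (mul_pos_of_neg_of_neg (hneg 0 1 (by decide)) (hneg 1 2 (by decide))) (hneg 2 0 (by decide))
    have hcycle₂ : k 0 (d 2) * k 1 (d 0) * k 2 (d 1) < 0 := mul_neg_of_pos_of_neg
      (mul_pos_of_neg_of_neg (hneg 0 2 (by decide)) (hneg 1 0 (by decide))) (hneg 2 1 (by decide))
    rw [Matrix.det_fin_three]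
    simp only [Matrix.of_apply, hzero]
    exact ne_of_lt (by linarith)
  refine Fintype.linearIndependent_iff.2 fun c hc => congrFun
    (Matrix.eq_zero_of_mulVec_eq_zero hdet (funext fun i => ?_))
  simpa [Matrix.mulVec, dotProduct, mul_comm] using congrArg (k i) hc

lemma not_wbtw_of_mem_vertexSet {x y z : V} (hx : x ∈ P) (hy : y ∈ vertexSet P) (hz : z ∈ P)
    (hyx : y ≠ x) (hyz : y ≠ z) : ¬ Wbtw ℝ x y z := by
  rw [← mem_segment_iff_wbtw, ← convexHull_pair]
  exact notMem_convexHull_of_mem_vertexSet hy (Set.pair_subset hx hz) (by simp [hyx, hyz])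

lemma IsPolytope.affDim_inter_vertexSet (hP : IsPolytope P) {F : Set V} (hF : F ∈ faceComplex P) :
    affDim (F ∩ vertexSet P) = affDim F := by
  rw [← affDim_convexHull, ← hP.face_eq_convexHull hF]

variable [FiniteDimensional ℝ V]

lemma eq_of_mem_faceComplex_of_affDim_le {F : Set V} (hF : F ∈ faceComplex P)
    (hd : affDim P ≤ affDim F) : F = P := by
  have hFP := subset_of_mem_faceComplex hF
  rcases F.eq_empty_or_nonempty with rfl | hne
  · rw [affDim_empty] at hd
    exact (affDim_eq_neg_one_iff.1 (hd.antisymm (neg_one_le_affDim P))).symm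
  · obtain ⟨l, M, -, rfl⟩ := exists_level_of_mem_faceComplex hF hne
    have hspan := affineSpan_eq_of_affDim_le hFP hne hd
    exact hFP.antisymm fun y hy =>
      ⟨hy, map_eq_of_mem_affineSpan (fun z hz => hz.2) (hspan ▸ subset_affineSpan ℝ P hy)⟩

lemma ncard_faces_affDim_self (P : Set V) :
    {F | F ∈ faceComplex P ∧ affDim F = affDim P}.ncard = 1 := by
  refine Set.ncard_eq_one.2 ⟨P, ?_⟩
  ext F
  simp only [Set.mem_ofPred_eq, Set.mem_singleton_iff]
  exact ⟨fun h => eq_of_mem_faceComplex_of_affDim_le h.1 h.2.ge,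
    fun h => ⟨h ▸ IsExposed.refl P, h ▸ rfl⟩⟩

lemma collinear_of_affDim_le_one {S : Set V} (h : affDim S ≤ 1) : Collinear ℝ S := by
  rcases S.eq_empty_or_nonempty with rfl | hS
  · exact collinear_empty ℝ V
  · rw [affDim_of_nonempty hS] at h
    exact collinear_iff_finrank_le_one.2 (by exact_mod_cast h)

namespace IsPolytope

lemma affDim_lt_ncard_vertexSet (hP : IsPolytope P) : affDim P < (vertexSet P).ncard := by
  have hle := affDim_finset_le hP.finite_vertexSet.toFinset
  rw [Set.Finite.coe_toFinset, hP.affDim_vertexSet,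
    ← Set.ncard_eq_toFinset_card _ hP.finite_vertexSet] at hle
  omega

lemma ncard_edge_inter_vertexSet (hP : IsPolytope P) {E : Set V} (hE : E ∈ edges P) :
    (E ∩ vertexSet P).ncard = 2 := by
  have hfin : (E ∩ vertexSet P).Finite := hP.finite_vertexSet.inter_of_right E
  have hd : affDim (E ∩ vertexSet P) = 1 := (hP.affDim_inter_vertexSet hE.1).trans hE.2
  apply le_antisymm
  · by_contra! hlt
    obtain ⟨x, hx, y, hy, z, hz, hxy, hxz, hyz⟩ := (Set.two_lt_ncard hfin).1 hlt
    have hsub : ({x, y, z} : Set V) ⊆ E ∩ vertexSet P :=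
      Set.insert_subset hx (Set.pair_subset hy hz)
    have hP' := vertexSet_subset P
    rcases (collinear_of_affDim_le_one ((affDim_mono hsub).trans hd.le)).wbtw_or_wbtw_or_wbtw
      with h | h | h
    · exact not_wbtw_of_mem_vertexSet (hP' hx.2) hy.2 (hP' hz.2) hxy.symm hyz h
    · exact not_wbtw_of_mem_vertexSet (hP' hy.2) hz.2 (hP' hx.2) hyz.symm hxz.symm h
    · exact not_wbtw_of_mem_vertexSet (hP' hz.2) hx.2 (hP' hy.2) hxz hxy h
  · have hle := affDim_finset_le hfin.toFinset
    rw [Set.Finite.coe_toFinset, hd, ← Set.ncard_eq_toFinset_card _ hfin] at hle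
    omega

lemma edge_eq_convexHull_pair (hP : IsPolytope P) {E : Set V} (hE : E ∈ edges P) {u y : V}
    (hu : u ∈ vertexSet P) (hy : y ∈ vertexSet P) (huy : u ≠ y) (huE : u ∈ E) (hyE : y ∈ E) :
    E = convexHull ℝ {u, y} := by
  have hpair : ({u, y} : Set V) = E ∩ vertexSet P :=
    Set.eq_of_subset_of_ncard_le (Set.pair_subset ⟨huE, hu⟩ ⟨hyE, hy⟩)
      (by rw [hP.ncard_edge_inter_vertexSet hE, Set.ncard_pair huy])
      (hP.finite_vertexSet.inter_of_right E)
  rw [hpair]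
  exact hP.face_eq_convexHull hE.1

lemma exists_ne_vertex_of_edge (hP : IsPolytope P) {E : Set V} (hE : E ∈ edges P) (u : V) :
    ∃ y ∈ E ∩ vertexSet P, y ≠ u :=
  Set.exists_ne_of_one_lt_ncard (by rw [hP.ncard_edge_inter_vertexSet hE]; exact one_lt_two) u

lemma exists_edge_of_vertex (hP : IsPolytope P) (hd : affDim P = 2) {u : V}
    (hu : u ∈ vertexSet P) {y : V} (hy : y ∈ P) (hyu : y ≠ u) : ∃ E ∈ edges P, u ∈ E ∧ y ∉ E := by
  obtain ⟨l, hl⟩ := exists_lt_of_mem_vertexSet hu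
  have huP := vertexSet_subset P hu
  have hle : ∀ y ∈ P, l y ≤ l u := fun y hy => by
    by_cases h : y = u
    · rw [h]
    · exact (hl y hy h).le
  obtain ⟨E, hE, hyE, hE'⟩ := hP.exists_facet_notMem hle ⟨u, huP, rfl⟩ hy (hl y hy hyu).ne
  exact ⟨E, edges_eq_facets hd ▸ hE, hE' u huP rfl, hyE⟩

lemma linearIndependent_of_edges (hP : IsPolytope P) {u : V} (hu : u ∈ vertexSet P)
    {E : Fin 3 → Set V} (hE : ∀ i, E i ∈ edges P) (huE : ∀ i, u ∈ E i)
    (hinj : Function.Injective E) {y : Fin 3 → V} (hy : ∀ i, y i ∈ E i ∩ vertexSet P)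
    (hyu : ∀ i, y i ≠ u) : LinearIndependent ℝ fun i => y i - u := by
  choose k M hle hEk using fun i => exists_level_of_mem_faceComplex (hE i).1 ⟨u, huE i⟩
  have huM : ∀ i, k i u = M i := fun i => by
    have := huE i
    rw [hEk i] at this
    exact this.2
  refine linearIndependent_of_map_neg (k := fun i => (k i : V →ₗ[ℝ] ℝ)) (fun i => ?_)
    fun i j hij => ?_
  · have hyE := (hy i).1
    rw [hEk i] at hyE
    simp [hyE.2, huM]
  · have hyE : y j ∉ E i := fun hyE => hij <| hinj <| by
      rw [hP.edge_eq_convexHull_pair (hE i) hu (hy j).2 (hyu j).symm (huE i) hyE,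
        hP.edge_eq_convexHull_pair (hE j) hu (hy j).2 (hyu j).symm (huE j) (hy j).1]
    have hyP := vertexSet_subset P (hy j).2
    rw [hEk i] at hyE
    simpa [huM] using (hle i _ hyP).lt_of_ne fun h => hyE ⟨hyP, h⟩

lemma ncard_edges_of_vertex (hP : IsPolytope P) (hd : affDim P = 2) {u : V}
    (hu : u ∈ vertexSet P) : {E ∈ edges P | u ∈ E}.ncard = 2 := by
  have huP := vertexSet_subset P hu
  have hfin : {E ∈ edges P | u ∈ E}.Finite := hP.finite_edges.sep _
  apply le_antisymm
  · by_contra! hlt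
    have : Fintype {E ∈ edges P | u ∈ E} := hfin.fintype
    rw [← Nat.card_coe_set_eq, Nat.card_eq_fintype_card] at hlt
    obtain ⟨E⟩ : Nonempty (Fin 3 ↪ {E ∈ edges P | u ∈ E}) :=
      Function.Embedding.nonempty_of_card_le (by rwa [Fintype.card_fin])
    choose y hy hyu using fun i => hP.exists_ne_vertex_of_edge (E i).2.1 u
    have hli := hP.linearIndependent_of_edges hu (fun i => (E i).2.1) (fun i => (E i).2.2)
      (Subtype.val_injective.comp E.injective) hy hyu
    have hle := Submodule.finrank_mono (Submodule.span_le.2 (Set.range_subset_iff.2 fun i =>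
      vsub_mem_vectorSpan ℝ (vertexSet_subset P (hy i).2) huP))
    rw [affDim_of_nonempty ⟨u, huP⟩] at hd
    simp only [vsub_eq_sub, finrank_span_eq_card hli, Fintype.card_fin] at hle
    omega
  · obtain ⟨y, hy, hyu⟩ : ∃ y ∈ P, y ≠ u := by
      by_contra! h
      have hle := affDim_mono (show P ⊆ {u} from h)
      rw [affDim_singleton, hd] at hle
      omega
    obtain ⟨E₁, hE₁, huE₁, -⟩ := hP.exists_edge_of_vertex hd hu hy hyu
    obtain ⟨z, hz, hzu⟩ := hP.exists_ne_vertex_of_edge hE₁ u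
    obtain ⟨E₂, hE₂, huE₂, hzE₂⟩ := hP.exists_edge_of_vertex hd hu (vertexSet_subset P hz.2) hzu
    exact (Set.one_lt_ncard hfin).2
      ⟨E₁, ⟨hE₁, huE₁⟩, E₂, ⟨hE₂, huE₂⟩, fun e => hzE₂ (e ▸ hz.1)⟩

lemma ncard_edges (hP : IsPolytope P) (hd : affDim P = 2) :
    (edges P).ncard = (vertexSet P).ncard := by
  classical
  have hcount := Finset.card_mul_eq_card_mul (s := hP.finite_vertexSet.toFinset)
    (t := hP.finite_edges.toFinset) (m := 2) (n := 2) (fun u E => u ∈ E) (fun u hu => ?_)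
    fun E hE => ?_
  · rw [Set.ncard_eq_toFinset_card _ hP.finite_vertexSet,
      Set.ncard_eq_toFinset_card _ hP.finite_edges]
    omega
  · rw [← hP.ncard_edges_of_vertex hd ((Set.Finite.mem_toFinset _).1 hu), ← Set.ncard_coe_finset]
    simp [Finset.bipartiteAbove]
  · rw [← hP.ncard_edge_inter_vertexSet ((Set.Finite.mem_toFinset _).1 hE),
      ← Set.ncard_coe_finset]
    congr 1
    ext u
    simp [Finset.bipartiteBelow, and_comm]

lemma fVector_of_affDim_two (hP : IsPolytope P) (hd : affDim P = 2) :
    fVector P = [1, (vertexSet P).ncard, (vertexSet P).ncard, 1] := by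
  have hself := ncard_faces_affDim_self P
  have hedges := hP.ncard_edges hd
  rw [hd] at hself
  rw [edges] at hedges
  rw [fVector_eq_map, hd, show ((2 : ℤ) + 2).toNat = 4 from rfl]
  simp [List.range_succ, ncard_faces_affDim_neg_one, ncard_faces_affDim_zero, hself, hedges]

end IsPolytope

end Polygon

section Bipyramid

variable {V : Type*} [NormedAddCommGroup V] [NormedSpace ℝ V] {P Q G : Set V} {v w p : V}

lemma map_le_of_mem_openSegment (hp : p ∈ openSegment ℝ v w) {l : StrongDual ℝ V}
    (h : l p ≤ l v) : l w ≤ l p := by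
  obtain ⟨a, b, ha, hb, hab, rfl⟩ := hp
  simp only [map_add, map_smul, smul_eq_mul] at h ⊢
  obtain rfl : a = 1 - b := by linarith
  have hwv : l w ≤ l v := le_of_mul_le_mul_left (by linarith) hb
  linarith [mul_le_mul_of_nonneg_left hwv ha.le]

lemma map_eq_of_mem_openSegment (hp : p ∈ openSegment ℝ v w) {l : StrongDual ℝ V}
    (h : l v = l p) : l w = l p :=
  (map_le_of_mem_openSegment hp h.ge).antisymm <| by
    simpa using map_le_of_mem_openSegment (l := -l) hp (by simpa using h.le)

lemma map_lt_of_mem_openSegment (hp : p ∈ openSegment ℝ v w) {l : StrongDual ℝ V}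
    (h : l p < l v) : l w < l p := by
  by_contra! hle
  rw [openSegment_symm] at hp
  exact h.not_ge (map_le_of_mem_openSegment hp hle)

lemma exists_mem_openSegment_map_eq {l : StrongDual ℝ V} {M : ℝ} (hv : M < l v) (hw : l w < M) :
    ∃ p ∈ openSegment ℝ v w, l p = M := by
  have hM : M ∈ l '' openSegment ℝ w v := by
    have himage : l '' openSegment ℝ w v = openSegment ℝ (l w) (l v) :=
      image_openSegment ℝ (l : V →ₗ[ℝ] ℝ).toAffineMap w v
    rw [openSegment_eq_Ioo (hw.trans hv)] at himage
    exact himage.superset ⟨hw, hv⟩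
  rwa [openSegment_symm] at hM

lemma map_lt_of_mem_intrinsicInterior (hp : p ∈ intrinsicInterior ℝ Q) {l : StrongDual ℝ V} {M : ℝ}
    (hl : ∀ y ∈ Q, l y ≤ M) (hne : {y ∈ Q | l y = M} ≠ Q) : l p < M :=
  (hl p (intrinsicInterior_subset hp)).lt_of_ne fun e => hne <|
    Set.sep_eq_self_iff_mem_true.2 (eq_of_mem_intrinsicInterior hp hl e)

/-- The faces of `P` other than `P` itself; the empty face is included. -/
def properFaces (P : Set V) : Set (Set V) := {F | F ∈ faceComplex P ∧ F ≠ P}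

lemma IsPolytope.finite_properFaces (hP : IsPolytope P) : (properFaces P).Finite :=
  hP.finite_faceComplex.subset fun _ hF => hF.1

lemma IsPolytope.convex_of_mem_faceComplex (hP : IsPolytope P) (hG : G ∈ faceComplex P) :
    Convex ℝ G := by
  rw [hP.face_eq_convexHull hG]
  exact convex_convexHull ℝ _

lemma exists_level_of_mem_properFaces (hG : G ∈ properFaces P) :
    ∃ (l : StrongDual ℝ V) (M : ℝ), (∀ x ∈ P, l x ≤ M) ∧ G = {x ∈ P | l x = M} := by
  rcases G.eq_empty_or_nonempty with rfl | hne
  · exact ⟨0, 1, by simp, by simp⟩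
  · exact exists_level_of_mem_faceComplex hG.1 hne

lemma ncard_faces_eq_ncard_properFaces {d : ℤ} (hd : d < affDim P) :
    {F | F ∈ faceComplex P ∧ affDim F = d}.ncard =
      {F | F ∈ properFaces P ∧ affDim F = d}.ncard := by
  congr 1
  ext F
  refine ⟨fun hF => ⟨⟨hF.1, ?_⟩, hF.2⟩, fun hF => ⟨hF.1.1, hF.2⟩⟩
  rintro rfl
  exact hd.ne' hF.2

/-- The bipyramid with base `Q` and apices `v` and `w`. -/
def bipyramid (Q : Set V) (v w : V) : Set V := convexHull ℝ (Q ∪ {v, w})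

/-- The cone with apex `v` over `G`, which is the point `v` if `G` is empty. -/
def coneOver (v : V) (G : Set V) : Set V := convexHull ℝ (insert v G)

/-- The points `v` and `w` are apices of a bipyramid over `Q`, the segment between them crossing
`Q` at `p`. -/
structure AreApices (Q : Set V) (v w p : V) : Prop where
  left_notMem : v ∉ affineSpan ℝ Q
  right_notMem : w ∉ affineSpan ℝ Q
  mem_openSegment : p ∈ openSegment ℝ v w
  mem_intrinsicInterior : p ∈ intrinsicInterior ℝ Q

lemma IsBipyramidOver.exists_areApices (h : IsBipyramidOver P Q) :
    ∃ v w p, AreApices Q v w p ∧ P = bipyramid Q v w := by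
  obtain ⟨v, w, hv, hw, ⟨p, hp, hpQ⟩, hP⟩ := h
  exact ⟨v, w, p, ⟨hv, hw, hp, hpQ⟩, hP⟩

lemma bipyramid_comm (Q : Set V) (v w : V) : bipyramid Q v w = bipyramid Q w v := by
  rw [bipyramid, bipyramid, Set.pair_comm]

lemma subset_bipyramid (Q : Set V) (v w : V) : Q ⊆ bipyramid Q v w :=
  Set.subset_union_left.trans (subset_convexHull ℝ _)

lemma left_mem_bipyramid (Q : Set V) (v w : V) : v ∈ bipyramid Q v w :=
  subset_convexHull ℝ _ (by simp)

lemma right_mem_bipyramid (Q : Set V) (v w : V) : w ∈ bipyramid Q v w :=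
  subset_convexHull ℝ _ (by simp)

lemma mem_coneOver (v : V) (G : Set V) : v ∈ coneOver v G :=
  subset_convexHull ℝ _ (Set.mem_insert v G)

lemma coneOver_empty (v : V) : coneOver v ∅ = {v} := by simp [coneOver]

lemma IsPolytope.bipyramid (hQ : IsPolytope Q) (v w : V) : IsPolytope (bipyramid Q v w) := by
  rw [_root_.bipyramid, ← hQ.convexHull_vertexSet, convexHull_convexHull_union_left]
  exact isPolytope_convexHull (hQ.finite_vertexSet.union (Set.toFinite _))

section Level

variable {l : StrongDual ℝ V} {M : ℝ}

lemma le_of_mem_bipyramid (hl : ∀ y ∈ Q, l y ≤ M) (hv : l v ≤ M) (hw : l w ≤ M) :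
    ∀ y ∈ bipyramid Q v w, l y ≤ M := fun y hy => by
  refine le_of_mem_convexHull ?_ hy
  rintro y (hy | rfl | rfl)
  exacts [hl y hy, hv, hw]

lemma bipyramid_level_eq (hl : ∀ y ∈ Q, l y ≤ M) (hv : l v ≤ M) (hw : l w ≤ M) :
    {x ∈ bipyramid Q v w | l x = M} = convexHull ℝ {x ∈ Q ∪ {v, w} | l x = M} :=
  setOf_mem_convexHull_and_map_eq fun y hy =>
    le_of_mem_bipyramid hl hv hw y (subset_convexHull ℝ _ hy)

lemma bipyramid_level_eq_convexHull (hl : ∀ y ∈ Q, l y ≤ M) (hv : l v < M) (hw : l w < M) :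
    {x ∈ bipyramid Q v w | l x = M} = convexHull ℝ {y ∈ Q | l y = M} := by
  rw [bipyramid_level_eq hl hv.le hw.le]
  congr 1
  ext y
  constructor
  · rintro ⟨hy | rfl | rfl, hyM⟩
    exacts [⟨hy, hyM⟩, absurd hyM hv.ne, absurd hyM hw.ne]
  · exact fun hy => ⟨Or.inl hy.1, hy.2⟩

lemma bipyramid_level_eq_coneOver (hl : ∀ y ∈ Q, l y ≤ M) (hv : l v = M) (hw : l w < M) :
    {x ∈ bipyramid Q v w | l x = M} = coneOver v {y ∈ Q | l y = M} := by
  rw [bipyramid_level_eq hl hv.le hw.le, coneOver]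
  congr 1
  ext y
  constructor
  · rintro ⟨hy | rfl | rfl, hyM⟩
    exacts [Or.inr ⟨hy, hyM⟩, Or.inl rfl, absurd hyM hw.ne]
  · rintro (rfl | hy)
    exacts [⟨by simp, hv⟩, ⟨Or.inl hy.1, hy.2⟩]

end Level

namespace AreApices

lemma symm (h : AreApices Q v w p) : AreApices Q w v p :=
  ⟨h.right_notMem, h.left_notMem, openSegment_symm ℝ v w ▸ h.mem_openSegment,
    h.mem_intrinsicInterior⟩

lemma mem_base (h : AreApices Q v w p) : p ∈ Q := intrinsicInterior_subset h.mem_intrinsicInterior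

lemma left_notMem_base (h : AreApices Q v w p) : v ∉ Q := fun hv =>
  h.left_notMem (subset_affineSpan ℝ Q hv)

lemma ne (h : AreApices Q v w p) : v ≠ w := by
  rintro rfl
  have hp := h.mem_openSegment
  rw [openSegment_same, Set.mem_singleton_iff] at hp
  exact h.left_notMem_base (hp ▸ h.mem_base)

/-- The segment between the apices of a bipyramid, which is a special 1-simplex of it. -/
def axis (h : AreApices Q v w p) : Affine.Simplex ℝ V 1 :=
  ⟨![v, w], affineIndependent_of_ne ℝ h.ne⟩

lemma range_axis (h : AreApices Q v w p) : Set.range h.axis.points = {v, w} := by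
  simp [axis, Set.pair_comm]

lemma map_lt_of_level_ne (h : AreApices Q v w p) {l : StrongDual ℝ V} {M : ℝ}
    (hl : ∀ x ∈ bipyramid Q v w, l x ≤ M)
    (hne : {x ∈ bipyramid Q v w | l x = M} ≠ bipyramid Q v w) : l p < M := by
  have hlQ : ∀ y ∈ Q, l y ≤ M := fun y hy => hl y (subset_bipyramid Q v w hy)
  have hv := hl v (left_mem_bipyramid Q v w)
  have hw := hl w (right_mem_bipyramid Q v w)
  refine (hlQ p h.mem_base).lt_of_ne fun hp => hne <| Set.sep_eq_self_iff_mem_true.2 ?_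
  have hvp : l v = M := hv.antisymm <| by
    simpa [hp] using map_le_of_mem_openSegment (l := -l) h.symm.mem_openSegment (by simpa [hp])
  have hwp := map_eq_of_mem_openSegment h.mem_openSegment (hvp.trans hp.symm)
  have hall : ∀ y ∈ Q ∪ {v, w}, l y = M := by
    rintro y (hy | rfl | rfl)
    exacts [eq_of_mem_intrinsicInterior h.mem_intrinsicInterior hlQ hp y hy, hvp, hwp.trans hp]
  exact fun x hx => map_eq_of_mem_affineSpan hall (convexHull_subset_affineSpan _ hx)

lemma exists_mem_properFaces (h : AreApices Q v w p) (hQ : IsPolytope Q) {F : Set V}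
    (hF : F ∈ properFaces (bipyramid Q v w)) :
    ∃ G ∈ properFaces Q, F = G ∨ F = coneOver v G ∨ F = coneOver w G := by
  obtain ⟨l, M, hl, rfl⟩ := exists_level_of_mem_properFaces hF
  have hlQ : ∀ y ∈ Q, l y ≤ M := fun y hy => hl y (subset_bipyramid Q v w hy)
  have hp := h.map_lt_of_level_ne hl hF.2
  have hface := level_mem_faceComplex hlQ
  refine ⟨{y ∈ Q | l y = M}, ⟨hface, fun e => hp.ne (e.superset h.mem_base).2⟩, ?_⟩
  rcases (hl v (left_mem_bipyramid Q v w)).lt_or_eq with hv | hv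
  · rcases (hl w (right_mem_bipyramid Q v w)).lt_or_eq with hw | hw
    · left
      rw [bipyramid_level_eq_convexHull hlQ hv hw,
        (hQ.convex_of_mem_faceComplex hface).convexHull_eq]
    · right; right
      rw [bipyramid_comm, bipyramid_level_eq_coneOver hlQ hw hv]
  · right; left
    rw [bipyramid_level_eq_coneOver hlQ hv]
    exact (map_lt_of_mem_openSegment h.mem_openSegment (hv ▸ hp)).trans hp

variable [FiniteDimensional ℝ V]

lemma exists_extension (h : AreApices Q v w p) (l : StrongDual ℝ V) {c : ℝ} (hc : l p ≤ c) :
    ∃ (k : StrongDual ℝ V) (m : ℝ), (∀ y ∈ Q, k y = l y + m) ∧ k v = c + m ∧ k w ≤ l p + m := by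
  obtain ⟨k, m, hk, hkv⟩ :=
    exists_strongDual_of_notMem_affineSpan ⟨p, h.mem_base⟩ h.left_notMem (c - l v)
  have hQ : ∀ y ∈ Q, (l + k) y = l y + m := fun y hy => by
    simp [hk y (subset_affineSpan ℝ Q hy)]
  have hv : (l + k) v = c + m := by
    rw [add_apply, hkv]
    ring
  refine ⟨l + k, m, hQ, hv, ?_⟩
  rw [← hQ p h.mem_base]
  refine map_le_of_mem_openSegment h.mem_openSegment ?_
  rw [hQ p h.mem_base, hv]
  gcongr

lemma mem_properFaces_bipyramid (h : AreApices Q v w p) (hQ : IsPolytope Q)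
    (hG : G ∈ properFaces Q) : G ∈ properFaces (bipyramid Q v w) := by
  have hconv := hQ.convex_of_mem_faceComplex hG.1
  obtain ⟨l, M, hl, rfl⟩ := exists_level_of_mem_properFaces hG
  have hp := map_lt_of_mem_intrinsicInterior h.mem_intrinsicInterior hl hG.2
  obtain ⟨k, m, hk, hv, hw⟩ := h.exists_extension l le_rfl
  have hkQ : ∀ y ∈ Q, k y ≤ M + m := fun y hy => by simpa [hk y hy] using hl y hy
  have hlevel : {y ∈ Q | l y = M} = {x ∈ bipyramid Q v w | k x = M + m} := by
    rw [bipyramid_level_eq_convexHull hkQ (by linarith) (by linarith), ← hconv.convexHull_eq]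
    congr 1
    ext y
    simp +contextual [hk]
  refine ⟨hlevel ▸ level_mem_faceComplex (le_of_mem_bipyramid hkQ (by linarith) (by linarith)),
    fun e => h.left_notMem_base (e.superset (left_mem_bipyramid Q v w)).1⟩

lemma coneOver_mem_properFaces (h : AreApices Q v w p) (hG : G ∈ properFaces Q) :
    coneOver v G ∈ properFaces (bipyramid Q v w) := by
  obtain ⟨l, M, hl, rfl⟩ := exists_level_of_mem_properFaces hG
  have hp := map_lt_of_mem_intrinsicInterior h.mem_intrinsicInterior hl hG.2
  obtain ⟨k, m, hk, hv, hw⟩ := h.exists_extension l hp.le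
  have hkQ : ∀ y ∈ Q, k y ≤ M + m := fun y hy => by simpa [hk y hy] using hl y hy
  have hlevel : coneOver v {y ∈ Q | l y = M} = {x ∈ bipyramid Q v w | k x = M + m} := by
    rw [bipyramid_level_eq_coneOver hkQ hv (by linarith)]
    congr 1
    ext y
    simp +contextual [hk]
  refine ⟨hlevel ▸ level_mem_faceComplex (le_of_mem_bipyramid hkQ hv.le (by linarith)), ?_⟩
  rw [hlevel]
  intro e
  have hpk := (e.superset (subset_bipyramid Q v w h.mem_base)).2
  rw [hk p h.mem_base] at hpk
  linarith

lemma mem_properFaces_bipyramid_iff (h : AreApices Q v w p) (hQ : IsPolytope Q) {F : Set V} :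
    F ∈ properFaces (bipyramid Q v w) ↔
      ∃ G ∈ properFaces Q, F = G ∨ F = coneOver v G ∨ F = coneOver w G := by
  refine ⟨h.exists_mem_properFaces hQ, ?_⟩
  rintro ⟨G, hG, rfl | rfl | rfl⟩
  · exact h.mem_properFaces_bipyramid hQ hG
  · exact h.coneOver_mem_properFaces hG
  · exact bipyramid_comm Q v w ▸ h.symm.coneOver_mem_properFaces hG

end AreApices

end Bipyramid

section BipyramidFaces

variable {V : Type*} [NormedAddCommGroup V] [NormedSpace ℝ V] [FiniteDimensional ℝ V]
  {P Q G : Set V} {v w p : V}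

lemma affDim_lt_of_mem_properFaces (hG : G ∈ properFaces P) : affDim G < affDim P := by
  by_contra! hd
  exact hG.2 (eq_of_mem_faceComplex_of_affDim_le hG.1 hd)

lemma affDim_coneOver (hv : v ∉ affineSpan ℝ Q) (hG : G ⊆ Q) :
    affDim (coneOver v G) = affDim G + 1 := by
  rw [coneOver, affDim_convexHull,
    affDim_insert_of_notMem fun h => hv (affineSpan_mono ℝ hG h)]

lemma coneOver_inter_base (hv : v ∉ affineSpan ℝ Q) (hG : G ⊆ Q) (hconv : Convex ℝ G) :
    coneOver v G ∩ Q = G := by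
  refine Set.Subset.antisymm (fun x hx => ?_) fun x hx =>
    ⟨subset_convexHull ℝ _ (Set.mem_insert_of_mem v hx), hG hx⟩
  obtain ⟨k, m, hk, hkv⟩ := exists_strongDual_of_notMem_affineSpan ⟨x, hx.2⟩ hv (-1)
  have hkQ : ∀ y ∈ Q, k y = m := fun y hy => hk y (subset_affineSpan ℝ Q hy)
  have hle : ∀ y ∈ insert v G, k y ≤ m := by
    rintro y (rfl | hy)
    exacts [by linarith, (hkQ y (hG hy)).le]
  have hlevel : {y ∈ insert v G | k y = m} ⊆ G := by
    rintro y ⟨rfl | hy, hky⟩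
    exacts [absurd hky (by linarith), hy]
  have hxk : x ∈ {y ∈ coneOver v G | k y = m} := ⟨hx.1, hkQ x hx.2⟩
  rw [coneOver, setOf_mem_convexHull_and_map_eq hle] at hxk
  exact convexHull_min hlevel hconv hxk

lemma IsPolytope.injOn_coneOver (hQ : IsPolytope Q) (hv : v ∉ affineSpan ℝ Q) :
    Set.InjOn (coneOver v) (faceComplex Q) := fun G hG G' hG' e => by
  rw [← coneOver_inter_base hv (subset_of_mem_faceComplex hG) (hQ.convex_of_mem_faceComplex hG), e,
    coneOver_inter_base hv (subset_of_mem_faceComplex hG') (hQ.convex_of_mem_faceComplex hG')]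

namespace AreApices

lemma affDim_bipyramid (h : AreApices Q v w p) : affDim (bipyramid Q v w) = affDim Q + 1 := by
  have hw : w ∈ affineSpan ℝ (insert v Q) := by
    by_contra hw
    obtain ⟨k, m, hk, hkw⟩ :=
      exists_strongDual_of_notMem_affineSpan (Set.insert_nonempty v Q) hw 1
    have hkv := hk v (mem_affineSpan ℝ (Set.mem_insert v Q))
    have hkp := hk p (mem_affineSpan ℝ (Set.mem_insert_of_mem v h.mem_base))
    linarith [map_eq_of_mem_openSegment h.mem_openSegment (hkv.trans hkp.symm)]
  have hunion : Q ∪ {v, w} = insert w (insert v Q) := by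
    rw [Set.union_comm, Set.insert_union, Set.singleton_union, Set.insert_comm]
  rw [bipyramid, affDim_convexHull, hunion, affDim_congr (affineSpan_insert_eq_affineSpan ℝ hw),
    affDim_insert_of_notMem h.left_notMem]

lemma right_notMem_coneOver (h : AreApices Q v w p) (hG : G ⊆ Q) : w ∉ coneOver v G := by
  obtain ⟨k, m, hk, hkv⟩ :=
    exists_strongDual_of_notMem_affineSpan ⟨p, h.mem_base⟩ h.left_notMem 1
  have hkQ : ∀ y ∈ Q, k y = m := fun y hy => hk y (subset_affineSpan ℝ Q hy)
  have hkw : k w < m := by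
    rw [← hkQ p h.mem_base]
    exact map_lt_of_mem_openSegment h.mem_openSegment (by linarith [hkQ p h.mem_base])
  have hle : ∀ y ∈ insert v G, (-k) y ≤ -m := by
    rintro y (rfl | hy)
    · simp [hkv]
    · simp [hkQ y (hG hy)]
  exact fun hw => (neg_le_neg_iff.1 (le_of_mem_convexHull hle hw)).not_gt hkw

lemma setOf_mem_properFaces_bipyramid (h : AreApices Q v w p) (hQ : IsPolytope Q) (d : ℤ) :
    {F | F ∈ properFaces (bipyramid Q v w) ∧ affDim F = d} =
      {G | G ∈ properFaces Q ∧ affDim G = d} ∪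
        (coneOver v '' {G | G ∈ properFaces Q ∧ affDim G = d - 1} ∪
          coneOver w '' {G | G ∈ properFaces Q ∧ affDim G = d - 1}) := by
  have hv : ∀ {G}, G ∈ properFaces Q → affDim (coneOver v G) = affDim G + 1 := fun hG =>
    affDim_coneOver h.left_notMem (subset_of_mem_faceComplex hG.1)
  have hw : ∀ {G}, G ∈ properFaces Q → affDim (coneOver w G) = affDim G + 1 := fun hG =>
    affDim_coneOver h.right_notMem (subset_of_mem_faceComplex hG.1)
  ext F
  simp only [Set.mem_ofPred_eq, h.mem_properFaces_bipyramid_iff hQ]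
  constructor
  · rintro ⟨⟨G, hG, rfl | rfl | rfl⟩, hd⟩
    · exact Or.inl ⟨hG, hd⟩
    · exact Or.inr (Or.inl ⟨G, ⟨hG, by rw [← hd, hv hG, add_sub_cancel_right]⟩, rfl⟩)
    · exact Or.inr (Or.inr ⟨G, ⟨hG, by rw [← hd, hw hG, add_sub_cancel_right]⟩, rfl⟩)
  · rintro (hF | ⟨G, ⟨hG, hd⟩, rfl⟩ | ⟨G, ⟨hG, hd⟩, rfl⟩)
    · exact ⟨⟨F, hF.1, Or.inl rfl⟩, hF.2⟩
    · exact ⟨⟨G, hG, Or.inr (Or.inl rfl)⟩, by rw [hv hG, hd, sub_add_cancel]⟩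
    · exact ⟨⟨G, hG, Or.inr (Or.inr rfl)⟩, by rw [hw hG, hd, sub_add_cancel]⟩

lemma ncard_properFaces_bipyramid (h : AreApices Q v w p) (hQ : IsPolytope Q) (d : ℤ) :
    {F | F ∈ properFaces (bipyramid Q v w) ∧ affDim F = d}.ncard =
      {G | G ∈ properFaces Q ∧ affDim G = d}.ncard +
        2 * {G | G ∈ properFaces Q ∧ affDim G = d - 1}.ncard := by
  set A := {G | G ∈ properFaces Q ∧ affDim G = d}
  set B := {G | G ∈ properFaces Q ∧ affDim G = d - 1}
  have hA : A.Finite := hQ.finite_properFaces.subset fun _ hG => hG.1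
  have hB : B.Finite := hQ.finite_properFaces.subset fun _ hG => hG.1
  have hBQ : B ⊆ faceComplex Q := fun G hG => hG.1.1
  have hcones : Disjoint (coneOver v '' B) (coneOver w '' B) := by
    rw [Set.disjoint_left]
    rintro _ ⟨G, hG, rfl⟩ ⟨G', -, e⟩
    exact h.right_notMem_coneOver (subset_of_mem_faceComplex (hBQ hG)) (e ▸ mem_coneOver w G')
  have hbase : Disjoint A (coneOver v '' B ∪ coneOver w '' B) := by
    rw [Set.disjoint_left]
    rintro F hF (⟨G, -, rfl⟩ | ⟨G, -, rfl⟩)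
    · exact h.left_notMem_base (subset_of_mem_faceComplex hF.1.1 (mem_coneOver v G))
    · exact h.symm.left_notMem_base (subset_of_mem_faceComplex hF.1.1 (mem_coneOver w G))
  rw [h.setOf_mem_properFaces_bipyramid hQ,
    Set.ncard_union_eq hbase hA ((hB.image _).union (hB.image _)),
    Set.ncard_union_eq hcones (hB.image _) (hB.image _),
    ((hQ.injOn_coneOver h.left_notMem).mono hBQ).ncard_image,
    ((hQ.injOn_coneOver h.right_notMem).mono hBQ).ncard_image, two_mul]

lemma ncard_faces_bipyramid (h : AreApices Q v w p) (hQ : IsPolytope Q) {d : ℤ}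
    (hd : d < affDim Q) :
    {F | F ∈ faceComplex (bipyramid Q v w) ∧ affDim F = d}.ncard =
      {G | G ∈ faceComplex Q ∧ affDim G = d}.ncard +
        2 * {G | G ∈ faceComplex Q ∧ affDim G = d - 1}.ncard := by
  rw [ncard_faces_eq_ncard_properFaces (by rw [h.affDim_bipyramid]; lia),
    h.ncard_properFaces_bipyramid hQ, ncard_faces_eq_ncard_properFaces hd,
    ncard_faces_eq_ncard_properFaces (by lia)]

lemma ncard_facets_bipyramid (h : AreApices Q v w p) (hQ : IsPolytope Q) :
    (facets (bipyramid Q v w)).ncard = 2 * (facets Q).ncard := by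
  have hempty : {G | G ∈ properFaces Q ∧ affDim G = affDim Q} = ∅ :=
    Set.eq_empty_of_forall_notMem fun G hG => (affDim_lt_of_mem_properFaces hG.1).ne hG.2
  rw [facets, h.affDim_bipyramid, add_sub_cancel_right, facets,
    ncard_faces_eq_ncard_properFaces (by rw [h.affDim_bipyramid]; lia),
    h.ncard_properFaces_bipyramid hQ, hempty, Set.ncard_empty, zero_add,
    ncard_faces_eq_ncard_properFaces (by lia)]

lemma fVector_bipyramid (h : AreApices Q v w p) (hQ : IsPolytope Q) (hd : affDim Q = 2) :
    fVector (bipyramid Q v w) =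
      [1, (vertexSet Q).ncard + 2, 3 * (vertexSet Q).ncard, 2 * (vertexSet Q).ncard, 1] := by
  have hP : affDim (bipyramid Q v w) = 3 := by rw [h.affDim_bipyramid, hd, two_add_one_eq_three]
  have hvertices := h.ncard_faces_bipyramid hQ (d := 0) (by lia)
  have hedges := h.ncard_faces_bipyramid hQ (d := 1) (by lia)
  have hfacets := h.ncard_facets_bipyramid hQ
  have hself := ncard_faces_affDim_self (bipyramid Q v w)
  have hQedges : {G | G ∈ faceComplex Q ∧ affDim G = 1}.ncard = (vertexSet Q).ncard :=
    hQ.ncard_edges hd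
  have hQfacets : facets Q = {G | G ∈ faceComplex Q ∧ affDim G = 1} := by
    rw [facets, hd, show (2 : ℤ) - 1 = 1 from rfl]
  rw [zero_sub, ncard_faces_affDim_zero Q, ncard_faces_affDim_neg_one] at hvertices
  rw [sub_self, hQedges, ncard_faces_affDim_zero Q] at hedges
  rw [facets, hP, hQfacets, hQedges, show (3 : ℤ) - 1 = 2 from rfl] at hfacets
  rw [hP] at hself
  rw [fVector_eq_map, hP, show ((3 : ℤ) + 2).toNat = 5 from rfl]
  norm_num [List.range_succ, ncard_faces_affDim_neg_one, hvertices, hedges, hfacets, hself]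
  ring

lemma vertexSet_bipyramid (h : AreApices Q v w p) (hQ : IsPolytope Q) (hd : 0 < affDim Q) :
    vertexSet (bipyramid Q v w) = vertexSet Q ∪ {v, w} := by
  have hempty : ∅ ∈ properFaces Q :=
    ⟨isExposed_empty, (Set.nonempty_of_mem h.mem_base).ne_empty.symm⟩
  apply Set.Subset.antisymm
  · rw [bipyramid, ← hQ.convexHull_vertexSet, convexHull_convexHull_union_left,
      hQ.convexHull_vertexSet]
    exact vertexSet_convexHull_subset _
  · rintro u (hu | rfl | rfl)
    · refine (h.mem_properFaces_bipyramid hQ ⟨hu, fun e => ?_⟩).1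
      rw [← e, affDim_singleton] at hd
      exact hd.false
    · rw [vertexSet, Set.mem_ofPred_eq, ← coneOver_empty]
      exact (h.coneOver_mem_properFaces hempty).1
    · rw [vertexSet, Set.mem_ofPred_eq, ← coneOver_empty, bipyramid_comm]
      exact (h.symm.coneOver_mem_properFaces hempty).1

lemma isSpecialSimplex_axis (h : AreApices Q v w p) (hQ : IsPolytope Q) (hd : 0 < affDim Q) :
    IsSpecialSimplex (bipyramid Q v w) h.axis := by
  refine ⟨fun i => ?_, fun F hF => ?_⟩
  · rw [h.vertexSet_bipyramid hQ hd]
    exact Or.inr (h.range_axis ▸ Set.mem_range_self i)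
  have hdim : affDim F = affDim Q := by rw [hF.2, h.affDim_bipyramid, add_sub_cancel_right]
  have hproper : F ≠ bipyramid Q v w := by
    rintro rfl
    exact absurd hF.2 (by lia)
  obtain ⟨G, hG, rfl | rfl | rfl⟩ := h.exists_mem_properFaces hQ ⟨hF.1, hproper⟩
  · exact absurd hdim (affDim_lt_of_mem_properFaces hG).ne
  · have hw := h.right_notMem_coneOver (subset_of_mem_faceComplex hG.1)
    refine Set.ncard_eq_one.2 ⟨0, Set.ext fun i => ?_⟩
    fin_cases i <;> simp [axis, mem_coneOver, hw]
  · have hv := h.symm.right_notMem_coneOver (subset_of_mem_faceComplex hG.1)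
    refine Set.ncard_eq_one.2 ⟨1, Set.ext fun i => ?_⟩
    fin_cases i <;> simp [axis, mem_coneOver, hv]

lemma isMeek_axis (h : AreApices Q v w p) (hQ : IsPolytope Q) (hd : 0 < affDim Q) :
    IsMeek (bipyramid Q v w) h.axis := by
  have hrange := (h.isSpecialSimplex_axis hQ hd).range_subset
  have hdisj : Disjoint (vertexSet Q) {v, w} := by
    rw [Set.disjoint_right]
    rintro u (rfl | rfl) hu
    · exact h.left_notMem_base (vertexSet_subset Q hu)
    · exact h.symm.left_notMem_base (vertexSet_subset Q hu)
  rw [(hQ.bipyramid v w).isMeek_iff hrange, h.range_axis, h.vertexSet_bipyramid hQ hd,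
    Set.union_sdiff_right, hdisj.sdiff_eq_left, hQ.affDim_vertexSet, h.affDim_bipyramid]
  simp

end AreApices

lemma mem_meekPolytopes_of_isBipyramidOver (hQ : IsPolytope Q) {n : ℕ} (hn : n ≠ 0)
    (hd : affDim Q = n) (h : IsBipyramidOver P Q) : P ∈ meekPolytopes V (n + 1) 1 := by
  obtain ⟨v, w, p, hvw, rfl⟩ := h.exists_areApices
  have hpos : 0 < affDim Q := by lia
  exact ⟨hQ.bipyramid v w, by rw [hvw.affDim_bipyramid, hd, Nat.cast_succ], hvw.axis,
    hvw.isSpecialSimplex_axis hQ hpos, hvw.isMeek_axis hQ hpos⟩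

lemma fVector_of_isBipyramidOver (hQ : IsPolytope Q) (hd : affDim Q = 2)
    (h : IsBipyramidOver P Q) :
    fVector P = [1, (vertexSet Q).ncard + 2, 3 * (vertexSet Q).ncard,
      2 * (vertexSet Q).ncard, 1] := by
  obtain ⟨v, w, p, hvw, rfl⟩ := h.exists_areApices
  exact hvw.fVector_bipyramid hQ hd

end BipyramidFaces

section BaseVertices

variable {V : Type*} [NormedAddCommGroup V] [NormedSpace ℝ V] {P : Set V}

/-- The vertices of `P` other than those of `s`. They span the base if `P` is a bipyramid with
axis `s`. -/
def baseVertices (P : Set V) {m : ℕ} (s : Affine.Simplex ℝ V m) : Set V :=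
  vertexSet P \ Set.range s.points

lemma baseVertices_subset {m : ℕ} (s : Affine.Simplex ℝ V m) : baseVertices P s ⊆ P :=
  Set.sdiff_subset.trans (vertexSet_subset P)

lemma IsPolytope.convexHull_baseVertices (hP : IsPolytope P) {m : ℕ} (s : Affine.Simplex ℝ V m) :
    IsPolytope (convexHull ℝ (baseVertices P s)) :=
  isPolytope_convexHull (hP.finite_vertexSet.subset Set.sdiff_subset)

namespace IsSpecialSimplex

lemma baseVertices_union_range {m : ℕ} {s : Affine.Simplex ℝ V m} (hs : IsSpecialSimplex P s) :
    baseVertices P s ∪ Set.range s.points = vertexSet P :=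
  Set.sdiff_union_of_subset (Set.range_subset_iff.2 hs.1)

lemma le_of_forall_baseVertices_le {m : ℕ} {s : Affine.Simplex ℝ V m} (hs : IsSpecialSimplex P s)
    (hP : IsPolytope P) {l : StrongDual ℝ V} {M : ℝ} (hbase : ∀ y ∈ baseVertices P s, l y ≤ M)
    (hv : ∀ i, l (s.points i) ≤ M) : ∀ y ∈ P, l y ≤ M :=
  hP.le_of_forall_vertexSet_le <| hs.baseVertices_union_range ▸ by
    rintro y (hy | ⟨i, rfl⟩)
    exacts [hbase y hy, hv i]

end IsSpecialSimplex

end BaseVertices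

section MeekIsBipyramid

variable {V : Type*} [NormedAddCommGroup V] [NormedSpace ℝ V] [FiniteDimensional ℝ V] {P : Set V}
  {s : Affine.Simplex ℝ V 1}

lemma mem_affineSpan_of_map_eq {S T : Set V} (hST : S ⊆ T) (hS : S.Nonempty)
    (hd : affDim T ≤ affDim S + 1) {k : StrongDual ℝ V} {m : ℝ} (hk : ∀ y ∈ S, k y = m) {x p : V}
    (hx : x ∈ T) (hkx : k x ≠ m) (hp : p ∈ affineSpan ℝ T) (hkp : k p = m) :
    p ∈ affineSpan ℝ S := by
  obtain ⟨y, hy⟩ := hS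
  have hlt : affDim {z ∈ (affineSpan ℝ T : Set V) | k z = m} < affDim T := by
    rw [← affDim_affineSpan T]
    exact affDim_level_lt ⟨y, mem_affineSpan ℝ (hST hy), hk y hy⟩
      (mem_affineSpan ℝ (mem_affineSpan ℝ hx)) hkx
  have hsub : S ⊆ {z ∈ (affineSpan ℝ T : Set V) | k z = m} := fun z hz =>
    ⟨mem_affineSpan ℝ (hST hz), hk z hz⟩
  rw [affineSpan_eq_of_affDim_le hsub ⟨y, hy⟩ (by lia)]
  exact mem_affineSpan ℝ ⟨hp, hkp⟩

namespace IsSpecialSimplex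

lemma notMem_affineSpan_baseVertices (hs : IsSpecialSimplex P s) (hP : IsPolytope P)
    (hd : affDim (baseVertices P s) < affDim P) (hne : (baseVertices P s).Nonempty) (i : Fin 2) :
    s.points i ∉ affineSpan ℝ (baseVertices P s) := by
  intro hi
  obtain ⟨y, hy⟩ := hne
  obtain ⟨j, hji⟩ := exists_ne i
  have hij : ∀ x, x = i ∨ x = j := by lia
  have hj : s.points j ∉ affineSpan ℝ (baseVertices P s) := by
    intro hj
    refine hd.not_ge ?_
    rw [← hP.affDim_vertexSet, ← affDim_affineSpan (baseVertices P s),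
      ← hs.baseVertices_union_range]
    refine affDim_mono (Set.union_subset (subset_affineSpan ℝ _) ?_)
    rintro _ ⟨x, rfl⟩
    rcases hij x with rfl | rfl
    exacts [hi, hj]
  obtain ⟨l, hl⟩ := exists_lt_of_mem_vertexSet (hs.1 i)
  obtain ⟨k, m, hk, hkj⟩ :=
    exists_strongDual_of_notMem_affineSpan ⟨y, hy⟩ hj (l (s.points i) - l (s.points j))
  have hlt : ∀ z ∈ baseVertices P s, (l + k) z < l (s.points i) + m := fun z hz => by
    simpa [hk z (mem_affineSpan ℝ hz)] using
      hl z (baseVertices_subset s hz) fun e => hz.2 ⟨i, e.symm⟩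
  have heq : ∀ x, (l + k) (s.points x) = l (s.points i) + m := fun x => by
    rcases hij x with rfl | rfl
    · rw [add_apply, hk _ hi]
    · rw [add_apply, hkj]
      ring
  have hle := hs.le_of_forall_baseVertices_le hP (fun z hz => (hlt z hz).le) fun x => (heq x).le
  exact (hlt y hy).ne (hs.eq_of_level hP hle heq y (baseVertices_subset s hy))

lemma map_lt_of_lt_map (hs : IsSpecialSimplex P s) (hP : IsPolytope P)
    (hd : affDim P = affDim (baseVertices P s) + 1) (hne : (baseVertices P s).Nonempty)
    {k : StrongDual ℝ V} {m : ℝ} (hk : ∀ y ∈ baseVertices P s, k y = m) {i j : Fin 2}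
    (hji : j ≠ i) (hi : m < k (s.points i)) : k (s.points j) < m := by
  by_contra! hj
  obtain ⟨y, hy⟩ := hne
  have hle : ∀ z ∈ P, (-k) z ≤ -m := by
    refine hs.le_of_forall_baseVertices_le hP (fun z hz => by simp [hk z hz]) fun x => ?_
    obtain rfl | rfl : x = i ∨ x = j := by lia
    exacts [neg_le_neg hi.le, neg_le_neg hj]
  obtain ⟨F, hF, hiF, hbase⟩ := hP.exists_facet_notMem hle
    ⟨y, baseVertices_subset s hy, by simp [hk y hy]⟩ (hs.range_subset ⟨i, rfl⟩)
    (neg_injective.ne hi.ne')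
  have hsub : insert (s.points j) (baseVertices P s) ⊆ F :=
    Set.insert_subset (hs.mem_of_ne hF hiF hji) fun z hz =>
      hbase z (baseVertices_subset s hz) (by simp [hk z hz])
  have hdim := affDim_mono hsub
  rw [affDim_insert_of_notMem
    (hs.notMem_affineSpan_baseVertices hP (by lia) ⟨y, hy⟩ j), hF.2] at hdim
  lia

lemma mem_intrinsicInterior_baseVertices (hs : IsSpecialSimplex P s) (hP : IsPolytope P)
    (h₀ : s.points 0 ∉ affineSpan ℝ (baseVertices P s)) (hne : (baseVertices P s).Nonempty) {p : V}
    (hp : p ∈ affineSpan ℝ (baseVertices P s))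
    (hpv : p ∈ openSegment ℝ (s.points 0) (s.points 1)) :
    p ∈ intrinsicInterior ℝ (convexHull ℝ (baseVertices P s)) := by
  by_contra hpi
  obtain ⟨l, M, hl, ⟨y, hy, hyM⟩, hlp⟩ :=
    (hP.convexHull_baseVertices s).exists_le_of_notMem_intrinsicInterior hne.convexHull
      (by rwa [affineSpan_convexHull]) hpi
  obtain ⟨k, m, hk, hk₀⟩ :=
    exists_strongDual_of_notMem_affineSpan hne h₀ (l p - l (s.points 0))
  have hlk₀ : (l + k) (s.points 0) = (l + k) p := by
    rw [add_apply, add_apply, hk₀, hk p hp]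
    ring
  have hlk : ∀ i, (l + k) (s.points i) = (l + k) p := by
    rw [Fin.forall_fin_two]
    exact ⟨hlk₀, map_eq_of_mem_openSegment hpv hlk₀⟩
  have hle : ∀ z ∈ P, (l + k) z ≤ (l + k) p :=
    hs.le_of_forall_baseVertices_le hP (fun z hz => by
      rw [add_apply, add_apply, hk z (mem_affineSpan ℝ hz), hk p hp]
      linarith [hl z (subset_convexHull ℝ _ hz)]) fun i => (hlk i).le
  have hyp := hs.eq_of_level hP hle hlk y (convexHull_min (baseVertices_subset s) hP.convex hy)
  rw [add_apply, add_apply, hk y (convexHull_subset_affineSpan _ hy), hk p hp] at hyp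
  linarith

lemma isBipyramidOver_convexHull_baseVertices (hs : IsSpecialSimplex P s) (hP : IsPolytope P)
    (hd : affDim P = affDim (baseVertices P s) + 1) (hne : (baseVertices P s).Nonempty) :
    IsBipyramidOver P (convexHull ℝ (baseVertices P s)) := by
  have hv := hs.notMem_affineSpan_baseVertices hP (by lia) hne
  have hvP : ∀ i, s.points i ∈ P := fun i => hs.range_subset ⟨i, rfl⟩
  obtain ⟨k, m, hk, hk₀⟩ := exists_strongDual_of_notMem_affineSpan hne (hv 0) 1
  have hkbase : ∀ y ∈ baseVertices P s, k y = m := fun y hy => hk y (mem_affineSpan ℝ hy)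
  have hk₁ : k (s.points 1) < m :=
    hs.map_lt_of_lt_map hP hd hne hkbase one_ne_zero (by linarith : m < k (s.points 0))
  obtain ⟨p, hp, hkp⟩ := exists_mem_openSegment_map_eq (by linarith : m < k (s.points 0)) hk₁
  have hpspan : p ∈ affineSpan ℝ (baseVertices P s) :=
    mem_affineSpan_of_map_eq (baseVertices_subset s) hne hd.le hkbase (hvP 0) (by linarith)
      (mem_affineSpan ℝ (hP.convex.openSegment_subset (hvP 0) (hvP 1) hp)) hkp
  refine ⟨s.points 0, s.points 1, ?_, ?_,
    ⟨p, hp, hs.mem_intrinsicInterior_baseVertices hP (hv 0) hne hpspan hp⟩, ?_⟩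
  · exact affineSpan_convexHull (𝕜 := ℝ) (baseVertices P s) ▸ hv 0
  · exact affineSpan_convexHull (𝕜 := ℝ) (baseVertices P s) ▸ hv 1
  · have hrange : Set.range s.points = {s.points 0, s.points 1} := by
      ext y
      simp [Fin.exists_fin_two, eq_comm]
    rw [convexHull_convexHull_union_left, ← hrange, hs.baseVertices_union_range,
      hP.convexHull_vertexSet]

end IsSpecialSimplex

lemma meekPolytopes_eq_bipyramids {n : ℕ} (hn : n ≠ 0) :
    meekPolytopes V (n + 1) 1 = {P | ∃ Q, IsPolytope Q ∧ affDim Q = n ∧ IsBipyramidOver P Q} := by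
  ext P
  constructor
  · rintro ⟨hP, hd, s, hs, hmeek⟩
    have hbase : affDim (baseVertices P s) = n := by
      rw [hP.isMeek_iff hs.range_subset, hd] at hmeek
      rw [baseVertices, hmeek]
      simp
    refine ⟨_, hP.convexHull_baseVertices s, by rw [affDim_convexHull, hbase], ?_⟩
    exact hs.isBipyramidOver_convexHull_baseVertices hP (by rw [hd, hbase, Nat.cast_succ])
      (nonempty_of_affDim_eq hbase)
  · rintro ⟨Q, hQ, hd, h⟩
    exact mem_meekPolytopes_of_isBipyramidOver hQ hn hd h

end MeekIsBipyramid

section Examples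

variable {V : Type*} [NormedAddCommGroup V] [NormedSpace ℝ V] {u : ℕ → V} {x₁ x₂ : StrongDual ℝ V}

/- The tangent to the parabola `x₂ = x₁ ^ 2` at the `i`-th point supports the polygon. -/
lemma vertexSet_convexHull_image_of_parabola (h₁ : ∀ i, x₁ (u i) = i)
    (h₂ : ∀ i, x₂ (u i) = (i : ℝ) ^ 2) (S : Set ℕ) :
    vertexSet (convexHull ℝ (u '' S)) = u '' S := by
  refine (vertexSet_convexHull_subset _).antisymm ?_
  rintro _ ⟨i, hi, rfl⟩
  refine mem_vertexSet_convexHull_of_lt (l := (2 * (i : ℝ)) • x₁ - x₂) ⟨i, hi, rfl⟩ ?_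
  rintro _ ⟨j, -, rfl⟩ hne
  have hsq : 0 < ((j : ℝ) - i) ^ 2 := by
    refine sq_pos_of_ne_zero (sub_ne_zero.2 fun e => hne ?_)
    rw [Nat.cast_injective e]
  simp only [sub_apply, smul_apply, smul_eq_mul, h₁, h₂]
  linarith

variable [FiniteDimensional ℝ V]

lemma affDim_image_of_parabola (h₁ : ∀ i, x₁ (u i) = i) (h₂ : ∀ i, x₂ (u i) = (i : ℝ) ^ 2) :
    affDim (u '' {0, 1, 2}) = 2 := by
  have hone : u 1 ∉ affineSpan ℝ {u 0} := fun h => by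
    have := map_eq_of_mem_affineSpan (l := x₁) (M := 0) (by simp [h₁]) h
    simp [h₁] at this
  have htwo : u 2 ∉ affineSpan ℝ {u 1, u 0} := fun h => by
    have := map_eq_of_mem_affineSpan (l := x₂ - x₁) (M := 0) (by simp [h₁, h₂]) h
    norm_num [h₁, h₂] at this
  have himage : u '' {0, 1, 2} = {u 2, u 1, u 0} := by
    rw [Set.image_insert_eq, Set.image_pair, Set.insert_comm, Set.pair_comm (u 0), Set.insert_comm]
  rw [himage, affDim_insert_of_notMem htwo, affDim_insert_of_notMem hone, affDim_singleton]
  norm_num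

lemma exists_parabola (hV : 2 ≤ Module.finrank ℝ V) :
    ∃ (u : ℕ → V) (x₁ x₂ : StrongDual ℝ V), (∀ i, x₁ (u i) = i) ∧ (∀ i, x₂ (u i) = (i : ℝ) ^ 2) ∧
      affDim (Set.range u) ≤ 2 := by
  let b := Module.finBasis ℝ V
  let e : Fin 2 → V := b ∘ Fin.castLE hV
  let x : Fin 2 → StrongDual ℝ V := fun i =>
    LinearMap.toContinuousLinearMap (b.coord (Fin.castLE hV i))
  have hxe : ∀ i j, x i (e j) = if i = j then 1 else 0 := fun i j => by
    simp [x, e, Finsupp.single_apply, eq_comm]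
  refine ⟨fun i => (i : ℝ) • e 0 + (i : ℝ) ^ 2 • e 1, x 0, x 1, fun i => by simp [hxe],
    fun i => by simp [hxe], ?_⟩
  rw [affDim_of_nonempty (Set.range_nonempty _)]
  have hsub : vectorSpan ℝ (Set.range fun i : ℕ => (i : ℝ) • e 0 + (i : ℝ) ^ 2 • e 1) ≤
      Submodule.span ℝ (Set.range e) := by
    have he : ∀ j, e j ∈ Submodule.span ℝ (Set.range e) := fun j => Submodule.subset_span ⟨j, rfl⟩
    have hmem : ∀ i : ℕ, (i : ℝ) • e 0 + (i : ℝ) ^ 2 • e 1 ∈ Submodule.span ℝ (Set.range e) :=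
      fun i => add_mem (Submodule.smul_mem _ _ (he 0)) (Submodule.smul_mem _ _ (he 1))
    refine Submodule.span_le.2 ?_
    rintro _ ⟨_, ⟨i, rfl⟩, _, ⟨j, rfl⟩, rfl⟩
    exact sub_mem (hmem i) (hmem j)
  exact_mod_cast (Submodule.finrank_mono hsub).trans (finrank_range_le_card e)

lemma exists_polygon (hV : 2 ≤ Module.finrank ℝ V) {k : ℕ} (hk : 3 ≤ k) :
    ∃ Q : Set V, IsPolytope Q ∧ affDim Q = 2 ∧ (vertexSet Q).ncard = k := by
  obtain ⟨u, x₁, x₂, h₁, h₂, hd⟩ := exists_parabola hV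
  have hinj : Function.Injective u := fun i j hij =>
    Nat.cast_injective (R := ℝ) (by rw [← h₁, ← h₁, hij])
  have htriangle : ({0, 1, 2} : Set ℕ) ⊆ Set.Iio k := by
    rintro i (rfl | rfl | rfl) <;> exact Set.mem_Iio.2 (by lia)
  refine ⟨convexHull ℝ (u '' Set.Iio k), isPolytope_convexHull ((Set.finite_Iio k).image u), ?_, ?_⟩
  · rw [affDim_convexHull]
    refine ((affDim_mono (Set.image_subset_range u _)).trans hd).antisymm ?_
    rw [← affDim_image_of_parabola h₁ h₂]
    exact affDim_mono (Set.image_mono htriangle)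
  · rw [vertexSet_convexHull_image_of_parabola h₁ h₂, Set.ncard_image_of_injective _ hinj]
    simp [Set.ncard_eq_toFinset_card']

lemma IsPolytope.exists_isBipyramidOver {Q : Set V} (hQ : IsPolytope Q) (hne : Q.Nonempty)
    (hd : affDim Q < Module.finrank ℝ V) : ∃ P, IsBipyramidOver P Q := by
  obtain ⟨v, hv⟩ : ∃ v, v ∉ affineSpan ℝ Q := by
    by_contra! h
    have htop : affineSpan ℝ Q = ⊤ := top_unique fun v _ => h v
    rw [affDim_of_nonempty hne, ← direction_affineSpan, htop, AffineSubspace.direction_top,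
      finrank_top] at hd
    exact hd.false
  obtain ⟨p, hp⟩ := hne.intrinsicInterior hQ.convex
  have hpspan := subset_affineSpan ℝ Q (intrinsicInterior_subset hp)
  refine ⟨_, v, p + (p - v), hv, fun hw => hv ?_, ⟨p, ?_, hp⟩, rfl⟩
  · have hmem := add_smul_sub_mem_affineSpan hpspan hpspan hw 1
    rwa [one_smul, sub_add_cancel_left, neg_sub, add_sub_cancel] at hmem
  · exact ⟨1 / 2, 1 / 2, by norm_num, by norm_num, by norm_num, by module⟩

end Examples

theorem mainTheorem10_general {V : Type*} [NormedAddCommGroup V] [NormedSpace ℝ V]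
    [FiniteDimensional ℝ V] :
    (specialPolytopes V 2 1 =
        {P | IsPolytope P ∧ fVector P = [1, 4, 4, 1]} ∧
      meekPolytopes V 2 1 =
        {P | IsPolytope P ∧ fVector P = [1, 4, 4, 1]}) ∧
    (specialPolytopes V 3 2 =
        {P | IsPolytope P ∧ (fVector P = [1, 5, 9, 6, 1] ∨ fVector P = [1, 5, 8, 5, 1])} ∧
      meekPolytopes V 3 2 =
        {P | IsPolytope P ∧ (fVector P = [1, 5, 9, 6, 1] ∨ fVector P = [1, 5, 8, 5, 1])}) ∧
    (meekPolytopes V 3 1 =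
        {P | ∃ Q, IsPolytope Q ∧ affDim Q = 2 ∧ IsBipyramidOver P Q} ∧
      (∀ P Q : Set V,
        IsPolytope Q → affDim Q = 2 → IsBipyramidOver P Q →
          ∃ k : ℕ, 3 ≤ k ∧ fVector Q = [1, k, k, 1] ∧
            fVector P = [1, k + 2, 3 * k, 2 * k, 1]) ∧
      (3 ≤ Module.finrank ℝ V → ∀ k : ℕ, 3 ≤ k →
        ∃ P ∈ meekPolytopes V 3 1,
          fVector P = [1, k + 2, 3 * k, 2 * k, 1])) := by
  refine ⟨⟨?_, meekPolytopes_two_one⟩, ⟨?_, meekPolytopes_three_two⟩,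
    meekPolytopes_eq_bipyramids two_ne_zero, fun P Q hQ hd h => ?_, fun hV k hk => ?_⟩
  · exact (specialPolytopes_eq_meekPolytopes 1).trans meekPolytopes_two_one
  · exact (specialPolytopes_eq_meekPolytopes 2).trans meekPolytopes_three_two
  · have hcard := hQ.affDim_lt_ncard_vertexSet
    exact ⟨(vertexSet Q).ncard, by lia, hQ.fVector_of_affDim_two hd,
      fVector_of_isBipyramidOver hQ hd h⟩
  · obtain ⟨Q, hQ, hd, rfl⟩ := exists_polygon (V := V) (by lia) hk
    obtain ⟨P, hP⟩ := hQ.exists_isBipyramidOver (nonempty_of_affDim_eq hd) (by lia)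
    exact ⟨P, mem_meekPolytopes_of_isBipyramidOver hQ two_ne_zero hd hP,
      fVector_of_isBipyramidOver hQ hd hP⟩

theorem mainTheorem10 (q : ℕ) :
    (specialPolytopes (EuclideanSpace ℝ (Fin q)) 2 1 =
        {P | IsPolytope P ∧ fVector P = [1, 4, 4, 1]} ∧
      meekPolytopes (EuclideanSpace ℝ (Fin q)) 2 1 =
        {P | IsPolytope P ∧ fVector P = [1, 4, 4, 1]}) ∧
    (specialPolytopes (EuclideanSpace ℝ (Fin q)) 3 2 =
        {P | IsPolytope P ∧ (fVector P = [1, 5, 9, 6, 1] ∨ fVector P = [1, 5, 8, 5, 1])} ∧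
      meekPolytopes (EuclideanSpace ℝ (Fin q)) 3 2 =
        {P | IsPolytope P ∧ (fVector P = [1, 5, 9, 6, 1] ∨ fVector P = [1, 5, 8, 5, 1])}) ∧
    (meekPolytopes (EuclideanSpace ℝ (Fin q)) 3 1 =
        {P | ∃ Q, IsPolytope Q ∧ affDim Q = 2 ∧ IsBipyramidOver P Q} ∧
      (∀ P Q : Set (EuclideanSpace ℝ (Fin q)),
        IsPolytope Q → affDim Q = 2 → IsBipyramidOver P Q →
          ∃ k : ℕ, 3 ≤ k ∧ fVector Q = [1, k, k, 1] ∧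
            fVector P = [1, k + 2, 3 * k, 2 * k, 1]) ∧
      (3 ≤ q → ∀ k : ℕ, 3 ≤ k →
        ∃ P ∈ meekPolytopes (EuclideanSpace ℝ (Fin q)) 3 1,
          fVector P = [1, k + 2, 3 * k, 2 * k, 1])) := by
  simpa only [finrank_euclideanSpace_fin] using
    mainTheorem10_general (V := EuclideanSpace ℝ (Fin q))
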